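/- **Model.** In the coordinator model, $k$ players, each holding a private input, communicate with a coordinator who has no input. There is a private channel between the coordinator and each player, and no channel between players. All parties have independent private coins (arbitrary probability spaces). Messages are self-delimiting: whether it is player $i$'s turn to speak is determined by the bits exchanged so far on channel $i$. Whenever the coordinator is not waiting for a player, it either sends a bit to a player of its choice or ends the protocol by outputting an answer, depending on its coins and on everything it has seen; what a player sends depends on its coins, its input and the bits on its own channel. The communication complexity $\mathrm{CC}(\Pi)\in\mathbb N\cup\{\infty\}$ of a protocol $\Pi$ is the maximum, over all inputs and all outcomes of the coins, of the total number of bits exchanged on all channels. $\Pi$ solves a problem with error at most $\delta$ if, on every admissible input, the probability over the coins that the coordinator does not output a correct answer is at most $\delta$; the $\delta$-error communication complexity $\mathrm{CC}_\delta$ of a problem is the minimum of $\mathrm{CC}(\Pi)$ over all such $\Pi$. We say that $\Pi$ *ends recognizably* if every player who has been contacted can tell from its channel when its conversation is over, that is, if on no channel a nonempty complete conversation is a proper prefix of another complete conversation on that channel (over all inputs and coins). **Problems.** In Set Disjointness $\mathrm{Disj}_{n,k}$ player $i$ receives $X^i\subseteq[n]$ and the coordinator has to decide whether $\bigcap_{i=1}^k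 X^i\neq\emptyset$. In (Promise) Task Allocation $\mathrm{TaskAlloc}_{n,k}$ player $i$ receives $X^i\subseteq[n]$, with the promise that $\bigcup_{i=1}^k X^i=[n]$, and the coordinator has to output an assignment $Y:[n]\to[k]$ with $j\in X^{Y(j)}$ for every $j\in[n]$. **Theorem.** 1. There is a constant $K>0$ such that for all $n,k\in\mathbb N$ and all $\delta\ge 0$: for every protocol $P$ that ends recognizably and solves $\mathrm{TaskAlloc}_{n,k}$ with error at most $\delta$, there is a protocol $Q$ that ends recognizably, solves $\mathrm{Disj}_{n,k}$ with error at most $\delta$, and satisfies $$\mathrm{CC}(Q)\le \mathrm{CC}(P)+K\,(n\log n+k).$$ 2. For every $\delta\in[0,1)$ there are $c>0$, $a_0>0$ and $n_0$ such that for all $a\ge a_0$, all $n\ge n_0$ and all $k\ge a\log n$, $$\mathrm{CC}_\delta(\mathrm{TaskAlloc}_{n,k})\ge c\,nk,$$ where the minimum in $\mathrm{CC}_\delta$ is over all protocols, whether or not they end recognizably. -/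

import Mathlib

open MeasureTheory
open scoped ENNReal

namespace Coordinator

/-- The bits exchanged so far in an execution with `k` players and a coordinator, in chronological
order. The entry `(i, b)` means that the bit `b` was sent on the private channel between player `i`
and the coordinator; whether it was sent by the player or by the coordinator is determined by the
earlier bits on that channel (see `Protocol.playerTurn`). -/
abbrev Transcript (k : ℕ) : Type := List (Fin k × Bool)

/-- The bits that were exchanged on the channel of player `i`; this is all that player `i` sees. -/
def channel {k : ℕ} (i : Fin k) (τ : Transcript k) : List Bool :=
  (τ.filter (fun e => decide (e.1 = i))).map Prod.snd

/-- A private-coin protocol in the coordinator model with `k` players, inputs in `In` and outputs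
in `Out`. The coordinator has no input. Every party has its own probability space of coins.

Messages are self-delimiting: whether it is player `i`'s turn to speak is a function `playerTurn i`
of the bits exchanged so far on channel `i`. A message is completed when the turn on its channel
changes. When the coordinator is not waiting for a player, it either outputs an answer (and the
protocol ends) or sends a bit to a player of its choice, depending on its coins and on everything
it has seen. A player's bits depend on its coins, on its input and on the bits on its channel. -/
structure Protocol (k : ℕ) (In Out : Type) where
  CoordCoins : Type
  PlayerCoins : Fin k → Type
  [coordSpace : MeasurableSpace CoordCoins]
  [playerSpace : ∀ i, MeasurableSpace (PlayerCoins i)]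
  coordLaw : Measure CoordCoins
  playerLaw : ∀ i, Measure (PlayerCoins i)
  [coordProb : IsProbabilityMeasure coordLaw]
  [playerProb : ∀ i, IsProbabilityMeasure (playerLaw i)]
  playerTurn : Fin k → List Bool → Bool
  coord : CoordCoins → Transcript k → Out ⊕ (Fin k × Bool)
  player : ∀ i, PlayerCoins i → In → List Bool → Bool
  measurableSet_coord : ∀ τ a, MeasurableSet {r | coord r τ = a}
  measurableSet_player : ∀ i x h b, MeasurableSet {r | player i r x h = b}

attribute [instance] Protocol.coordSpace Protocol.playerSpace
  Protocol.coordProb Protocol.playerProb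

namespace Protocol

variable {k : ℕ} {In Out : Type}

/-- The outcomes of all the coins: those of the coordinator and those of each player. -/
abbrev Coins (P : Protocol k In Out) : Type := P.CoordCoins × (∀ i, P.PlayerCoins i)

/-- The coins of the different parties are independent. -/
noncomputable def law (P : Protocol k In Out) : Measure P.Coins :=
  P.coordLaw.prod (Measure.pi P.playerLaw)

/-- What happens after the transcript `τ`, on input `X` and coins `ρ`: an output of the coordinator
or one more bit on one channel. The execution is sequential, so that the only player who can be
due to speak is the one on whose channel the last bit was sent. -/
def next (P : Protocol k In Out) (X : Fin k → In) (ρ : P.Coins) (τ : Transcript k) :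
    Out ⊕ (Fin k × Bool) :=
  match τ.getLast? with
  | none => P.coord ρ.1 τ
  | some (i, _) =>
      if P.playerTurn i (channel i τ) = true then
        Sum.inr (i, P.player i (ρ.2 i) (X i) (channel i τ))
      else P.coord ρ.1 τ

/-- The transcript after `m` steps; it does not change any more once the coordinator has given
its output. -/
def exec (P : Protocol k In Out) (X : Fin k → In) (ρ : P.Coins) : ℕ → Transcript k
  | 0 => []
  | m + 1 =>
      match P.next X ρ (P.exec X ρ m) with
      | Sum.inl _ => P.exec X ρ m
      | Sum.inr e => P.exec X ρ m ++ [e]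

/-- On input `X` and coins `ρ` the protocol ends with the complete transcript `τ`, and the
coordinator outputs `y`. -/
def Ends (P : Protocol k In Out) (X : Fin k → In) (ρ : P.Coins) (τ : Transcript k) (y : Out) :
    Prop :=
  (∃ m, P.exec X ρ m = τ) ∧ P.next X ρ τ = Sum.inl y

/-- The communication complexity of a protocol: the maximum, over all inputs and all outcomes of
the coins, of the total number of bits exchanged on all channels (infinite if unbounded). -/
noncomputable def cost (P : Protocol k In Out) : ℕ∞ :=
  ⨆ (X : Fin k → In) (ρ : P.Coins) (m : ℕ), ((P.exec X ρ m).length : ℕ∞)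

/-- Every player who has been contacted can tell from its channel when its conversation with the
coordinator is over: a nonempty complete conversation on a channel is never a proper prefix of
another complete conversation on that channel. -/
def EndsRecognizably (P : Protocol k In Out) : Prop :=
  ∀ (i : Fin k) (X X' : Fin k → In) (ρ ρ' : P.Coins) (τ τ' : Transcript k) (y y' : Out),
    P.Ends X ρ τ y → P.Ends X' ρ' τ' y' →
      channel i τ ≠ [] → channel i τ <+: channel i τ' → channel i τ = channel i τ'

end Protocol

/-- A communication problem with `k` players: the admissible inputs, and which outputs are correct
on an input. -/
structure Problem (k : ℕ) (In Out : Type) where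
  promise : (Fin k → In) → Prop
  correct : (Fin k → In) → Out → Prop

/-- On every input that satisfies the promise, the probability over the private coins that the
coordinator does not output a correct answer is at most `δ`. -/
def Protocol.Solves {k : ℕ} {In Out : Type} (P : Protocol k In Out) (Q : Problem k In Out)
    (δ : ℝ) : Prop :=
  ∀ X, Q.promise X →
    P.law {ρ | ¬ ∃ τ y, P.Ends X ρ τ y ∧ Q.correct X y} ≤ ENNReal.ofReal δ

/-- The `δ`-error randomized communication complexity of a problem in the coordinator model. -/
noncomputable def Problem.cc {k : ℕ} {In Out : Type} (Q : Problem k In Out) (δ : ℝ) : ℕ∞ :=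
  ⨅ (P : Protocol k In Out) (_ : P.Solves Q δ), P.cost

/-- Set Disjointness: decide whether some element of `[n]` belongs to all the sets. -/
def setDisjointness (n k : ℕ) : Problem k (Finset (Fin n)) Bool where
  promise _ := True
  correct X y := y = true ↔ ∃ j, ∀ i, j ∈ X i

/-- Task Allocation: under the promise that every task can be performed by some player, assign
every task to a player who can perform it. -/
def taskAllocation (n k : ℕ) : Problem k (Finset (Fin n)) (Fin n → Fin k) where
  promise X := ∀ j, ∃ i, j ∈ X i
  correct X Y := ∀ j, j ∈ X (Y j)

end Coordinator

/-!
*Task allocation decides set disjointness.* Run `P` on the complements of the inputs. If the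
intersection is empty, the complements cover all tasks, and a correct assignment `Y` gives every
`j` to a player with `j ∉ X (Y j)`; if it is not empty, then `j ∈ X (Y j)` for some `j`, whatever
`Y` is. So it suffices to send every player its tasks under `Y`, which takes `O(n log n + k)` bits,
and to ask each for one bit. Players must know when the messages of `P` are over. Since `P` ends
recognizably, this is visible on every channel that `P` uses; to settle the others, each channel
opens with an extra bit, `false` at its first use by `P`, and `true` if `P` never used it.

*The lower bound.* Every task gets a random owner. A random task `j` is given to its owner only, the
others also to further random players. If `j` is given to a second random player as well, the two
are interchangeable, so that the owner is picked as often as the second player, with probability at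
most `1 / k` for an average one, if giving `j` to the extra player is hardly noticed. By cut and
paste, the conversation of a player has rectangular fibres; in the hard distribution the input of
the player and the rest are independent given a random set; and by the level-one inequality a
conversation of `L` bits has influences of total squared weight `O(L)` on the coordinates. Hence a
protocol of cost `o(nk)` barely notices a typical entry.
-/

namespace Coordinator

open scoped BigOperators

/-! ### Transcripts, prefixes and cut and paste -/

section Channel

variable {k : ℕ} {i : Fin k}

@[simp] theorem channel_nil (i : Fin k) : channel i ([] : Transcript k) = [] := rfl

theorem channel_append (i : Fin k) (τ σ : Transcript k) :
    channel i (τ ++ σ) = channel i τ ++ channel i σ := by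
  simp [channel]

theorem channel_concat (i : Fin k) (τ : Transcript k) (e : Fin k × Bool) :
    channel i (τ ++ [e]) = channel i τ ++ if e.1 = i then [e.2] else [] := by
  rw [channel_append]
  by_cases h : e.1 = i <;> simp [channel, h]

theorem channel_map_mk (i i' : Fin k) (w : List Bool) :
    channel i (w.map (fun b => (i', b))) = if i' = i then w else [] := by
  induction w with
  | nil => simp
  | cons b w ih =>
    rw [List.map_cons, ← List.singleton_append, channel_append, ih]
    by_cases h : i' = i <;> simp [channel, h]

theorem channel_prefix_channel {τ σ : Transcript k} (i : Fin k) (h : τ <+: σ) :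
    channel i τ <+: channel i σ := by
  obtain ⟨l, rfl⟩ := h
  exact channel_append i τ l ▸ List.prefix_append _ _

theorem channel_ne_nil_of_getLast? {τ : Transcript k} {b : Bool}
    (h : τ.getLast? = some (i, b)) : channel i τ ≠ [] := by
  obtain ⟨σ, rfl⟩ := List.getLast?_eq_some_iff.1 h
  simp [channel_concat]

theorem sum_length_channel (τ : Transcript k) : ∑ i, (channel i τ).length = τ.length := by
  induction τ using List.reverseRecOn with
  | nil => simp
  | append_singleton τ e ih =>
    simp only [channel_concat, List.length_append, Finset.sum_add_distrib, ih]
    simp [apply_ite List.length]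

end Channel

namespace Protocol

variable {k : ℕ} {In Out : Type} (P : Protocol k In Out) {X X' : Fin k → In} {ρ ρ' : P.Coins}
  {τ τ' : Transcript k} {y y' : Out} {m m' : ℕ}

instance : IsProbabilityMeasure P.law := by
  unfold law; infer_instance

/-- After the transcript `τ` the coordinator is waiting for a player, who is due to speak. -/
def IsWaiting (τ : Transcript k) : Prop :=
  ∃ i b, τ.getLast? = some (i, b) ∧ P.playerTurn i (channel i τ) = true

theorem next_of_playerTurn {i : Fin k} {b : Bool} (h : τ.getLast? = some (i, b))
    (ht : P.playerTurn i (channel i τ) = true) :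
    P.next X ρ τ = Sum.inr (i, P.player i (ρ.2 i) (X i) (channel i τ)) := by
  simp [next, h, ht]

theorem next_of_not_isWaiting (h : ¬ P.IsWaiting τ) : P.next X ρ τ = P.coord ρ.1 τ := by
  unfold next
  split
  case h_1 => rfl
  case h_2 i b hlast => exact if_neg fun ht => h ⟨i, b, hlast, ht⟩

theorem next_eq_inl_iff :
    P.next X ρ τ = Sum.inl y ↔ ¬ P.IsWaiting τ ∧ P.coord ρ.1 τ = Sum.inl y := by
  by_cases h : P.IsWaiting τ
  · obtain ⟨i, b, hlast, ht⟩ := id h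
    simp [P.next_of_playerTurn hlast ht, h]
  · simp [P.next_of_not_isWaiting h, h]

theorem exec_succ_of_inr {e : Fin k × Bool} (h : P.next X ρ (P.exec X ρ m) = Sum.inr e) :
    P.exec X ρ (m + 1) = P.exec X ρ m ++ [e] := by
  simp [exec, h]

theorem exec_succ_of_inl (h : P.next X ρ (P.exec X ρ m) = Sum.inl y) :
    P.exec X ρ (m + 1) = P.exec X ρ m := by
  simp [exec, h]

theorem exec_succ_cases (X : Fin k → In) (ρ : P.Coins) (m : ℕ) :
    (∃ y, P.next X ρ (P.exec X ρ m) = Sum.inl y ∧ P.exec X ρ (m + 1) = P.exec X ρ m) ∨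
    ∃ e, P.next X ρ (P.exec X ρ m) = Sum.inr e ∧ P.exec X ρ (m + 1) = P.exec X ρ m ++ [e] := by
  rcases h : P.next X ρ (P.exec X ρ m) with y | e
  · exact Or.inl ⟨y, rfl, P.exec_succ_of_inl h⟩
  · exact Or.inr ⟨e, rfl, P.exec_succ_of_inr h⟩

theorem exec_prefix_exec (X : Fin k → In) (ρ : P.Coins) (h : m ≤ m') :
    P.exec X ρ m <+: P.exec X ρ m' := by
  induction h with
  | refl => exact List.prefix_refl _
  | step _ ih =>
    refine ih.trans ?_
    rcases P.exec_succ_cases X ρ _ with ⟨y, -, h⟩ | ⟨e, -, h⟩ <;> rw [h]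
    exact List.prefix_append _ _

theorem exec_eq_of_inl (h : P.next X ρ (P.exec X ρ m) = Sum.inl y) (hm : m ≤ m') :
    P.exec X ρ m' = P.exec X ρ m := by
  induction hm with
  | refl => rfl
  | step _ ih =>
    rw [← ih] at h
    rw [← ih, P.exec_succ_of_inl h]

variable {P}

theorem Ends.exec_isPrefix (h : P.Ends X ρ τ y) (m : ℕ) : P.exec X ρ m <+: τ := by
  obtain ⟨⟨m', rfl⟩, h⟩ := h
  rcases le_total m m' with hm | hm
  · exact P.exec_prefix_exec X ρ hm
  · rw [P.exec_eq_of_inl h hm]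

theorem Ends.unique (h : P.Ends X ρ τ y) (h' : P.Ends X ρ τ' y') : τ = τ' ∧ y = y' := by
  obtain rfl : τ = τ' := by
    obtain ⟨m, rfl⟩ := h.1
    obtain ⟨m', rfl⟩ := h'.1
    exact (h'.exec_isPrefix m).eq_of_length_le (h.exec_isPrefix m').length_le
  exact ⟨rfl, Sum.inl.inj (h.2.symm.trans h'.2)⟩

variable (P)

theorem length_exec_eq_or_ends (X : Fin k → In) (ρ : P.Coins) (m : ℕ) :
    (P.exec X ρ m).length = m ∨ ∃ y, P.Ends X ρ (P.exec X ρ m) y := by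
  induction m with
  | zero => exact Or.inl rfl
  | succ m ih =>
    rcases P.exec_succ_cases X ρ m with ⟨y, hy, h⟩ | ⟨e, he, h⟩
    · exact Or.inr ⟨y, ⟨m + 1, rfl⟩, by rw [h, hy]⟩
    · rcases ih with ih | ⟨y, hy⟩
      · left; rw [h]; simp [ih]
      · rw [hy.2] at he; simp at he

theorem length_exec_le_cost (X : Fin k → In) (ρ : P.Coins) (m : ℕ) :
    ((P.exec X ρ m).length : ℕ∞) ≤ P.cost :=
  le_iSup_of_le X (le_iSup_of_le ρ (le_iSup (fun m => ((P.exec X ρ m).length : ℕ∞)) m))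

theorem exists_ends_exec {C : ℕ} (hC : P.cost ≤ C) (X : Fin k → In) (ρ : P.Coins) :
    ∃ y, P.Ends X ρ (P.exec X ρ (C + 1)) y := by
  refine (P.length_exec_eq_or_ends X ρ (C + 1)).resolve_left fun h => ?_
  have hle := (P.length_exec_le_cost X ρ (C + 1)).trans hC
  rw [h, Nat.cast_le] at hle
  omega

theorem getLast?_exec_of_playerTurn (X : Fin k → In) (ρ : P.Coins) (m : ℕ) (i : Fin k)
    (hne : channel i (P.exec X ρ m) ≠ [])
    (ht : P.playerTurn i (channel i (P.exec X ρ m)) = true) :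
    ∃ b, (P.exec X ρ m).getLast? = some (i, b) := by
  induction m with
  | zero => simp [exec] at hne
  | succ m ih =>
    rcases P.exec_succ_cases X ρ m with ⟨y, -, h⟩ | ⟨e, he, h⟩
    · rw [h] at hne ht ⊢; exact ih hne ht
    · rw [h] at hne ht ⊢
      by_cases hi : e.1 = i
      · exact ⟨e.2, by simp [← hi]⟩
      · rw [channel_concat, if_neg hi, List.append_nil] at hne ht
        obtain ⟨b, hb⟩ := ih hne ht
        rw [P.next_of_playerTurn hb ht, Sum.inr.injEq] at he
        exact absurd (congrArg Prod.fst he.symm) hi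

theorem eq_player_of_append_prefix_channel (X : Fin k → In) (ρ : P.Coins) (m : ℕ) (i : Fin k)
    {h : List Bool} {b : Bool} (hne : h ≠ []) (hp : h ++ [b] <+: channel i (P.exec X ρ m))
    (ht : P.playerTurn i h = true) : b = P.player i (ρ.2 i) (X i) h := by
  induction m with
  | zero => simp [exec] at hp
  | succ m ih =>
    rcases P.exec_succ_cases X ρ m with ⟨y, -, hm⟩ | ⟨e, he, hm⟩
    · rw [hm] at hp; exact ih hp
    · rw [hm, channel_concat] at hp
      split_ifs at hp with hi
      · rcases List.prefix_concat_iff.1 hp with hp | hp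
        · obtain ⟨rfl, hb⟩ := List.append_inj' hp rfl
          obtain ⟨b', hb'⟩ := P.getLast?_exec_of_playerTurn X ρ m i hne ht
          rw [P.next_of_playerTurn hb' ht, Sum.inr.injEq] at he
          rw [← he] at hb
          simpa using hb
        · exact ih hp
      · rw [List.append_nil] at hp; exact ih hp

theorem next_update_of_channel_eq {N : ℕ} {i : Fin k}
    (h : channel i (P.exec X ρ N) = channel i (P.exec X' ρ N)) (hm : m < N) :
    P.next (Function.update X' i (X i)) ρ (P.exec X' ρ m) = P.next X' ρ (P.exec X' ρ m) := by
  by_cases hw : P.IsWaiting (P.exec X' ρ m)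
  · obtain ⟨j, b, hlast, ht⟩ := hw
    have hnext := P.next_of_playerTurn (X := X') (ρ := ρ) hlast ht
    rw [P.next_of_playerTurn hlast ht, hnext]
    by_cases hj : j = i
    · subst hj
      have hsaid : channel j (P.exec X' ρ m) ++
          [P.player j (ρ.2 j) (X' j) (channel j (P.exec X' ρ m))] <+:
          channel j (P.exec X ρ N) := by
        have := channel_prefix_channel j (P.exec_prefix_exec X' ρ hm)
        rwa [P.exec_succ_of_inr hnext, channel_concat, if_pos rfl, ← h] at this
      rw [P.eq_player_of_append_prefix_channel X ρ N j (channel_ne_nil_of_getLast? hlast) hsaid ht,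
        Function.update_self]
    · rw [Function.update_of_ne hj]
  · rw [P.next_of_not_isWaiting hw, P.next_of_not_isWaiting hw]

/-- Cut and paste: the transcript determines everything player `i` sees, so its input may be
exchanged for any other input under which its channel carries the same bits. -/
theorem exec_update_of_channel_eq {N : ℕ} {i : Fin k}
    (h : channel i (P.exec X ρ N) = channel i (P.exec X' ρ N)) (hm : m ≤ N) :
    P.exec (Function.update X' i (X i)) ρ m = P.exec X' ρ m := by
  induction m with
  | zero => rfl
  | succ m ih => simp only [exec, ih (by omega), P.next_update_of_channel_eq h hm]

end Protocol

/-! ### Information in the conversation of one player -/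

section Expect

variable {ι A A' B M : Type*} [Fintype ι] [Fintype A] [Fintype A']
  [AddCommMonoid M] [Module ℚ≥0 M]

theorem expect_expect [Fintype B] (Φ : A → B → M) :
    𝔼 a, 𝔼 b, Φ a b = 𝔼 p : A × B, Φ p.1 p.2 := by
  rw [← Finset.expect_product' Finset.univ Finset.univ Φ, Finset.univ_product_univ]

theorem expect_expect_arrow [DecidableEq ι] [Fintype B] (Φ : (ι → A) → (ι → B) → M) :
    𝔼 f, 𝔼 g, Φ f g = 𝔼 h : ι → A × B, Φ (fun l => (h l).1) (fun l => (h l).2) := by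
  rw [expect_expect]
  exact (Fintype.expect_equiv (Equiv.arrowProdEquivProdArrow ι (fun _ => A) (fun _ => B)) _ _
    (fun h => rfl)).symm

theorem expect_prod_arrow [DecidableEq ι] (h : ι → A → ℝ) :
    𝔼 g : ι → A, ∏ l, h l (g l) = ∏ l, 𝔼 a, h l a := by
  have hsum : ∏ l, ∑ a, h l a = ∑ g : ι → A, ∏ l, h l (g l) := by
    rw [Finset.prod_univ_sum, Fintype.piFinset_univ]
  simp only [Fintype.expect_eq_sum_div_card]
  rw [← hsum, Finset.prod_div_distrib]
  simp

theorem expect_comp_arrow [DecidableEq ι] [Fintype B] [DecidableEq B] (F : A → B)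
    (φ : (ι → B) → ℝ) :
    𝔼 g : ι → A, φ (fun l => F (g l)) =
      ∑ W : ι → B, (∏ l, 𝔼 a, if F a = W l then (1 : ℝ) else 0) * φ W := by
  have hφ (g : ι → A) : φ (fun l => F (g l)) =
      ∑ W : ι → B, (∏ l, if F (g l) = W l then (1 : ℝ) else 0) * φ W := by
    rw [Finset.sum_eq_single (fun l => F (g l)) (fun W _ hW => ?_) (by simp)]
    · simp
    · obtain ⟨l, hl⟩ := Function.ne_iff.1 hW
      rw [Finset.prod_eq_zero (Finset.mem_univ l) (if_neg hl.symm), zero_mul]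
  simp only [hφ]
  rw [Finset.expect_sum_comm]
  refine Finset.sum_congr rfl fun W _ => ?_
  rw [← Finset.expect_mul, expect_prod_arrow (fun l a => if F a = W l then (1 : ℝ) else 0)]

theorem expect_arrow_congr [DecidableEq ι] [Finite B] (F : A → B) (F' : A' → B)
    (h : ∀ ψ : B → ℝ, 𝔼 a, ψ (F a) = 𝔼 a, ψ (F' a)) (φ : (ι → B) → ℝ) :
    𝔼 g : ι → A, φ (fun l => F (g l)) = 𝔼 g : ι → A', φ (fun l => F' (g l)) := by
  classical
  have := Fintype.ofFinite B
  rw [expect_comp_arrow, expect_comp_arrow]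
  refine Finset.sum_congr rfl fun W _ => ?_
  congr 1
  exact Finset.prod_congr rfl fun l _ => h (fun b => if b = W l then 1 else 0)

theorem expect_expect_update [DecidableEq ι] (i : ι) (h : (ι → A) → M) :
    𝔼 ρ : ι → A, 𝔼 s, h (Function.update ρ i s) = 𝔼 ρ, h ρ := by
  rcases isEmpty_or_nonempty A with hA | hA
  · have : IsEmpty (ι → A) := ⟨fun f => hA.false (f i)⟩
    simp [Finset.expect]
  have hswap : Function.Involutive
      (fun p : (ι → A) × A => (Function.update p.1 i p.2, p.1 i)) := fun p => by simp
  have hfst : 𝔼 ρ : ι → A, h ρ = 𝔼 p : (ι → A) × A, h p.1 := by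
    rw [← expect_expect fun ρ (_ : A) => h ρ]
    simp
  rw [expect_expect, hfst]
  exact Fintype.expect_equiv hswap.toPerm _ _ fun p => rfl

theorem expect_bool (f : Bool → ℝ) : 𝔼 b, f b = (f true + f false) / 2 := by
  rw [Fintype.expect_eq_sum_div_card, Fintype.sum_bool]; simp

theorem expect_bool_prod {B : Type*} [Fintype B] (Φ : Bool × B → ℝ) :
    𝔼 p, Φ p = (𝔼 b, Φ (true, b) + 𝔼 b, Φ (false, b)) / 2 := by
  rw [← expect_bool fun c => 𝔼 b, Φ (c, b), expect_expect fun c b => Φ (c, b)]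

theorem expect_arrow_bool [DecidableEq ι] (f : (ι → Bool) → ℝ) (j : ι) :
    𝔼 e, f e =
      (𝔼 e, f (Function.update e j true) + 𝔼 e, f (Function.update e j false)) / 2 := by
  rw [← expect_expect_update j, ← Finset.expect_add_distrib, Finset.expect_div]
  exact Finset.expect_congr rfl fun e _ => expect_bool _

theorem exp_mul_expect_le_expect_exp {f g : A → ℝ} (hf₀ : 0 ≤ f) (hf₁ : f ≤ 1) {S : ℝ}
    (hg : 𝔼 a, f a * g a = S * 𝔼 a, f a) :
    Real.exp S * 𝔼 a, f a ≤ 𝔼 a, Real.exp (g a) := by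
  have htangent (a : A) : Real.exp S * (1 + (g a - S)) ≤ Real.exp (g a) := by
    calc Real.exp S * (1 + (g a - S)) ≤ Real.exp S * Real.exp (g a - S) := by
          gcongr; linarith [Real.add_one_le_exp (g a - S)]
      _ = Real.exp (g a) := by rw [← Real.exp_add, add_sub_cancel]
  calc Real.exp S * 𝔼 a, f a = 𝔼 a, f a * (Real.exp S * (1 + (g a - S))) := by
        have hexpand (a : A) : f a * (Real.exp S * (1 + (g a - S))) =
            Real.exp S * (f a * g a) + Real.exp S * (1 - S) * f a := by ring
        simp only [hexpand]
        rw [Finset.expect_add_distrib, ← Finset.mul_expect, ← Finset.mul_expect, hg]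
        ring
    _ ≤ 𝔼 a, Real.exp (g a) := Finset.expect_le_expect fun a _ =>
        (mul_le_mul_of_nonneg_left (htangent a) (hf₀ a)).trans
          (mul_le_of_le_one_left (Real.exp_pos _).le (hf₁ a))

end Expect

section LevelOne

variable {ι : Type*} [Fintype ι] [DecidableEq ι] {f : (ι → Bool) → ℝ}

/-- The nontrivial character of `Bool`. The first Fourier coefficients of a function `f` on the
cube are the averages `𝔼 e, f e * boolSign (e j)`, up to sign. -/
def boolSign (b : Bool) : ℝ := if b then 1 else -1

theorem expect_mul_boolSign (f : (ι → Bool) → ℝ) (j : ι) :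
    𝔼 e, f e * boolSign (e j) =
      (𝔼 e, f (Function.update e j true) - 𝔼 e, f (Function.update e j false)) / 2 := by
  rw [expect_arrow_bool _ j]
  simp [boolSign, Finset.expect_neg_distrib, sub_eq_add_neg]

theorem expect_exp_sum_boolSign_le (b : ι → ℝ) :
    𝔼 e : ι → Bool, Real.exp (∑ j, b j * boolSign (e j)) ≤ Real.exp ((∑ j, b j ^ 2) / 2) := by
  have hcosh (j : ι) : 𝔼 s, Real.exp (b j * boolSign s) = Real.cosh (b j) := by
    rw [expect_bool, Real.cosh_eq]; simp [boolSign]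
  simp only [Finset.sum_div, Real.exp_sum]
  rw [expect_prod_arrow (fun j s => Real.exp (b j * boolSign s))]
  simp only [hcosh]
  exact Finset.prod_le_prod (fun j _ => (Real.cosh_pos _).le)
    fun j _ => Real.cosh_le_exp_half_sq _

/-- The level-one inequality: compare `f` with the exponential of the linear function given by its
own normalized first Fourier coefficients. -/
theorem sum_sq_expect_mul_boolSign_le (hf₀ : 0 ≤ f) (hf₁ : f ≤ 1) (hpos : 0 < 𝔼 e, f e) :
    ∑ j, (𝔼 e, f e * boolSign (e j)) ^ 2 ≤ 2 * (𝔼 e, f e) * Real.negMulLog (𝔼 e, f e) := by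
  set μ := 𝔼 e, f e
  set b : ι → ℝ := fun j => (𝔼 e, f e * boolSign (e j)) / μ with hb
  have hcoeff (j : ι) : 𝔼 e, f e * boolSign (e j) = μ * b j := by
    rw [hb, mul_div_cancel₀ _ hpos.ne']
  have hcorr : 𝔼 e, f e * ∑ j, b j * boolSign (e j) = (∑ j, b j ^ 2) * μ := by
    simp only [Finset.mul_sum, mul_left_comm (f _)]
    rw [Finset.expect_sum_comm, Finset.sum_mul]
    refine Finset.sum_congr rfl fun j _ => ?_
    rw [← Finset.mul_expect, hcoeff]
    ring
  have hexp : Real.exp (∑ j, b j ^ 2) * μ ≤ Real.exp ((∑ j, b j ^ 2) / 2) :=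
    (exp_mul_expect_le_expect_exp hf₀ hf₁ hcorr).trans (expect_exp_sum_boolSign_le b)
  have hlog : ∑ j, b j ^ 2 ≤ -2 * Real.log μ := by
    have := Real.log_le_log (by positivity) hexp
    rw [Real.log_mul (by positivity) hpos.ne', Real.log_exp, Real.log_exp] at this
    linarith
  calc ∑ j, (𝔼 e, f e * boolSign (e j)) ^ 2 = μ ^ 2 * ∑ j, b j ^ 2 := by
        simp only [hcoeff, mul_pow, Finset.mul_sum]
    _ ≤ μ ^ 2 * (-2 * Real.log μ) := by gcongr
    _ = 2 * μ * Real.negMulLog μ := by rw [Real.negMulLog]; ring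

theorem sum_abs_expect_mul_boolSign_le (hf₀ : 0 ≤ f) (hf₁ : f ≤ 1) {η : ℝ} (hη : 0 < η) :
    ∑ j, |𝔼 e, f e * boolSign (e j)| ≤
      Fintype.card ι * (η / 2) * (𝔼 e, f e) + Real.negMulLog (𝔼 e, f e) / η := by
  rcases (Finset.expect_nonneg (s := Finset.univ) fun e _ => hf₀ e).eq_or_lt with hzero | hpos
  · rw [(Fintype.expect_eq_zero_iff_of_nonneg hf₀).1 hzero.symm]
    simp
  set μ := 𝔼 e, f e
  have hamgm (t : ℝ) : |t| ≤ η / 2 * μ + t ^ 2 / (2 * η * μ) := by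
    have hsq : η / 2 * μ + t ^ 2 / (2 * η * μ) - |t| = (η * μ - |t|) ^ 2 / (2 * η * μ) := by
      rw [← sq_abs t]; field_simp; ring
    rw [← sub_nonneg, hsq]
    positivity
  calc ∑ j, |𝔼 e, f e * boolSign (e j)|
      ≤ ∑ j, (η / 2 * μ + (𝔼 e, f e * boolSign (e j)) ^ 2 / (2 * η * μ)) :=
        Finset.sum_le_sum fun j _ => hamgm _
    _ = Fintype.card ι * (η / 2) * μ +
          (∑ j, (𝔼 e, f e * boolSign (e j)) ^ 2) / (2 * η * μ) := by
        rw [Finset.sum_add_distrib, Finset.sum_div]; simp; ring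
    _ ≤ Fintype.card ι * (η / 2) * μ + 2 * μ * Real.negMulLog μ / (2 * η * μ) := by
        gcongr; exact sum_sq_expect_mul_boolSign_le hf₀ hf₁ hpos
    _ = Fintype.card ι * (η / 2) * μ + Real.negMulLog μ / η := by
        field_simp

end LevelOne

section ConversationLaw

variable {𝒰 : Type*} [Fintype 𝒰]

/-- Gibbs' inequality against the subprobability weights `exp (-w u)`. -/
theorem sum_negMulLog_le {p w : 𝒰 → ℝ} (hp : 0 ≤ p) (hp₁ : ∑ u, p u = 1)
    (hw : ∑ u, Real.exp (-w u) ≤ 1) : ∑ u, Real.negMulLog (p u) ≤ ∑ u, p u * w u := by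
  have hterm (u : 𝒰) : Real.negMulLog (p u) ≤ p u * w u + (Real.exp (-w u) - p u) := by
    have hratio := mul_le_mul_of_nonneg_left (Real.negMulLog_le_one_sub_self
      (mul_nonneg (hp u) (Real.exp_pos (w u)).le)) (Real.exp_pos (-w u)).le
    rw [Real.negMulLog_mul, Real.negMulLog, Real.negMulLog, Real.log_exp] at hratio
    have hcancel : Real.exp (-w u) * Real.exp (w u) = 1 := by rw [← Real.exp_add]; simp
    rw [Real.negMulLog]
    linear_combination hratio - (p u + (-p u * Real.log (p u)) - p u * w u) * hcancel
  calc ∑ u, Real.negMulLog (p u) ≤ ∑ u, (p u * w u + (Real.exp (-w u) - p u)) :=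
        Finset.sum_le_sum fun u _ => hterm u
    _ ≤ ∑ u, p u * w u := by
        rw [Finset.sum_add_distrib, Finset.sum_sub_distrib, hp₁]; linarith

variable {X Y : Type*}

/-- The law of the conversation `u` of two parties with inputs `x` and `y` and private coins: the
probability of `u` is a product `a u x * b u y`. -/
structure IsConversationLaw (a : 𝒰 → X → ℝ) (b : 𝒰 → Y → ℝ) : Prop where
  nonneg_left (u : 𝒰) : 0 ≤ a u
  le_one_left (u : 𝒰) : a u ≤ 1
  nonneg_right (u : 𝒰) : 0 ≤ b u
  le_one_right (u : 𝒰) : b u ≤ 1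
  sum_mul_eq_one (x : X) (y : Y) : ∑ u, a u x * b u y = 1

theorem abs_sub_mul_le {a₀ a₁ b₀ b₁ : ℝ} (ha₀ : 0 ≤ a₀) (ha₁ : 0 ≤ a₁) (hb₀ : 0 ≤ b₀)
    (hb₁ : 0 ≤ b₁) :
    |a₁ - a₀| * b₁ ≤ (a₁ - a₀) * b₁ + 6 * (|a₁ - a₀| * b₀) + 3 * (a₀ * |b₁ - b₀|) := by
  have hA := abs_nonneg (a₁ - a₀)
  have hA' := neg_abs_le (a₁ - a₀)
  by_cases h : b₁ ≤ 3 * b₀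
  · nlinarith [mul_nonneg hA (sub_nonneg.2 h), mul_nonneg ha₀ (abs_nonneg (b₁ - b₀)),
      mul_nonneg hb₁ (by linarith : 0 ≤ (a₁ - a₀) + |a₁ - a₀|)]
  · have hb : |b₁ - b₀| = b₁ - b₀ := abs_of_nonneg (by linarith)
    have h3 : |a₁ - a₀| ≤ a₁ - a₀ + 2 * a₀ := by
      rw [abs_le]; constructor <;> linarith
    rw [hb]
    nlinarith [mul_le_mul_of_nonneg_right h3 hb₁, mul_nonneg hA hb₀,
      mul_nonneg ha₀ (by linarith : 0 ≤ b₁ - 3 * b₀)]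

namespace IsConversationLaw

variable {a : 𝒰 → X → ℝ} {b : 𝒰 → Y → ℝ}

theorem symm (h : IsConversationLaw a b) : IsConversationLaw b a :=
  ⟨h.nonneg_right, h.le_one_right, h.nonneg_left, h.le_one_left,
    fun y x => by simpa only [mul_comm] using h.sum_mul_eq_one x y⟩

theorem comp {X' Y' : Type*} (h : IsConversationLaw a b) (f : X' → X) (g : Y' → Y) :
    IsConversationLaw (fun u x => a u (f x)) (fun u y => b u (g y)) :=
  ⟨fun u _ => h.nonneg_left u _, fun u _ => h.le_one_left u _, fun u _ => h.nonneg_right u _,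
    fun u _ => h.le_one_right u _, fun x y => h.sum_mul_eq_one (f x) (g y)⟩

theorem expect_right {S : Type*} [Fintype S] [Nonempty S] (h : IsConversationLaw a b) :
    IsConversationLaw a (fun u (y : S → Y) => 𝔼 s, b u (y s)) where
  nonneg_left := h.nonneg_left
  le_one_left := h.le_one_left
  nonneg_right u _ := Finset.expect_nonneg fun _ _ => h.nonneg_right u _
  le_one_right u _ := Finset.expect_le Finset.univ_nonempty fun _ _ => h.le_one_right u _
  sum_mul_eq_one x y := by
    simp only [Finset.mul_expect]
    rw [← Finset.expect_sum_comm]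
    simp [h.sum_mul_eq_one]

theorem sum_abs_sub_mul_le (h : IsConversationLaw a b) (x₀ x₁ : X) (y₀ y₁ : Y) :
    ∑ u, |a u x₁ - a u x₀| * b u y₁ ≤
      6 * ∑ u, |a u x₁ - a u x₀| * b u y₀ + 3 * ∑ u, |b u y₁ - b u y₀| * a u x₀ := by
  have hcancel : ∑ u, (a u x₁ - a u x₀) * b u y₁ = 0 := by
    simp only [sub_mul, Finset.sum_sub_distrib, h.sum_mul_eq_one, sub_self]
  calc ∑ u, |a u x₁ - a u x₀| * b u y₁
      ≤ ∑ u, ((a u x₁ - a u x₀) * b u y₁ + 6 * (|a u x₁ - a u x₀| * b u y₀) +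
          3 * (a u x₀ * |b u y₁ - b u y₀|)) :=
        Finset.sum_le_sum fun u _ => abs_sub_mul_le (h.nonneg_left u _) (h.nonneg_left u _)
          (h.nonneg_right u _) (h.nonneg_right u _)
    _ = _ := by
        rw [Finset.sum_add_distrib, Finset.sum_add_distrib, hcancel, zero_add,
          ← Finset.mul_sum, ← Finset.mul_sum]
        simp only [mul_comm]

end IsConversationLaw

end ConversationLaw

section Masked

variable {ι 𝒰 : Type*} [Fintype ι] [DecidableEq ι] [Fintype 𝒰]

/-- The average of `f` over the uniformly random subsets of `c`. -/
noncomputable def maskMean (f : (ι → Bool) → ℝ) (c : ι → Bool) : ℝ := 𝔼 e, f (c ⊓ e)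

/-- The average of `f` over the uniformly random subsets of `c`, once the bit `j` has been
replaced by `v`. -/
noncomputable def maskMeanAt (f : (ι → Bool) → ℝ) (c : ι → Bool) (j : ι) (v : Bool) : ℝ :=
  maskMean (fun x => f (Function.update x j v)) c

theorem maskMeanAt_update (f : (ι → Bool) → ℝ) (c : ι → Bool) (j : ι) (s v : Bool) :
    maskMeanAt f (Function.update c j s) j v = maskMeanAt f c j v := by
  refine Finset.expect_congr rfl fun e _ => congrArg f (funext fun l => ?_)
  by_cases hl : l = j <;> simp [hl]

theorem maskMeanAt_false {c : ι → Bool} {j : ι} (hc : c j = false) (f : (ι → Bool) → ℝ) :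
    maskMeanAt f c j false = maskMean f c := by
  refine Finset.expect_congr rfl fun e _ => congrArg f ?_
  simp [hc]

theorem two_mul_expect_mul_boolSign {c : ι → Bool} {j : ι} (hc : c j = true)
    (f : (ι → Bool) → ℝ) :
    2 * 𝔼 e, f (c ⊓ e) * boolSign (e j) = maskMeanAt f c j true - maskMeanAt f c j false := by
  have hupd (v : Bool) (e : ι → Bool) :
      c ⊓ Function.update e j v = Function.update (c ⊓ e) j v := by
    funext l
    by_cases hl : l = j
    · subst hl; simp [hc]
    · simp [hl]
  rw [expect_mul_boolSign (fun e => f (c ⊓ e)), mul_div_cancel₀ _ two_ne_zero]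
  simp only [hupd, maskMeanAt, maskMean]

theorem compl_update {ι : Type*} [DecidableEq ι] (c : ι → Bool) (j : ι) (s : Bool) :
    (Function.update c j s)ᶜ = Function.update cᶜ j (!s) := by
  funext l
  by_cases hl : l = j <;> simp [hl]

theorem expect_compl (F : (ι → Bool) → ℝ) : 𝔼 c, F cᶜ = 𝔼 c, F c :=
  Fintype.expect_equiv (compl_involutive (α := ι → Bool)).toPerm _ _ fun _ => rfl

/-- How well a conversation with law `a u x * b u y` tells apart the values of the bit `j` of `x`
when the bit `j` of `y` is `v`, the other bits of `x` and `y` being random, supported on `c` and off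
`c` respectively. -/
noncomputable def bitInfluence (a b : 𝒰 → (ι → Bool) → ℝ) (c : ι → Bool) (j : ι) (v : Bool) : ℝ :=
  ∑ u, |maskMeanAt (a u) c j true - maskMeanAt (a u) c j false| * maskMeanAt (b u) cᶜ j v

variable {a b : 𝒰 → (ι → Bool) → ℝ}

theorem bitInfluence_update (c : ι → Bool) (j : ι) (s v : Bool) :
    bitInfluence a b (Function.update c j s) j v = bitInfluence a b c j v := by
  simp only [bitInfluence, compl_update, maskMeanAt_update]

namespace IsConversationLaw

theorem masked (h : IsConversationLaw a b) :
    IsConversationLaw (fun u => maskMean (a u)) (fun u => maskMean (b u)) :=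
  (h.expect_right.symm.expect_right.symm).comp (fun c e => c ⊓ e) (fun c e => c ⊓ e)

theorem bitInfluence_true_le (h : IsConversationLaw a b) (c : ι → Bool) (j : ι) :
    bitInfluence a b c j true ≤
      6 * bitInfluence a b c j false + 3 * bitInfluence b a cᶜ j false := by
  have := (h.expect_right.symm.expect_right.symm).sum_abs_sub_mul_le
    (fun e => Function.update (c ⊓ e) j false) (fun e => Function.update (c ⊓ e) j true)
    (fun e => Function.update (cᶜ ⊓ e) j false) (fun e => Function.update (cᶜ ⊓ e) j true)
  simpa only [bitInfluence, compl_compl, maskMeanAt, maskMean] using this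

theorem expect_bitInfluence_false_le (h : IsConversationLaw a b) (j : ι) :
    𝔼 c, bitInfluence a b c j false ≤
      4 * 𝔼 c, ∑ u, |𝔼 e, a u (c ⊓ e) * boolSign (e j)| * maskMean (b u) cᶜ := by
  set G : (ι → Bool) → ℝ := fun c =>
    2 * ∑ u, |𝔼 e, a u (c ⊓ e) * boolSign (e j)| * maskMean (b u) cᶜ with hG
  have hG₀ (c : ι → Bool) : 0 ≤ G c := mul_nonneg two_pos.le <| Finset.sum_nonneg fun u _ =>
    mul_nonneg (abs_nonneg _) (h.masked.nonneg_right u _)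
  have htrue (c : ι → Bool) : bitInfluence a b c j false = G (Function.update c j true) := by
    rw [← bitInfluence_update c j true, bitInfluence]
    simp only [hG, Finset.mul_sum]
    refine Finset.sum_congr rfl fun u _ => ?_
    rw [← two_mul_expect_mul_boolSign (Function.update_self j true c),
      maskMeanAt_false (by simp), abs_mul, abs_two, mul_assoc]
  calc 𝔼 c, bitInfluence a b c j false = 𝔼 c, G (Function.update c j true) :=
        Finset.expect_congr rfl fun c _ => htrue c
    _ ≤ 2 * 𝔼 c, G c := by
        rw [expect_arrow_bool G j]
        linarith [Finset.expect_nonneg (s := Finset.univ)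
          fun (c : ι → Bool) _ => hG₀ (Function.update c j false)]
    _ = _ := by rw [← Finset.mul_expect, ← mul_assoc]; norm_num

variable {w : 𝒰 → ℝ} {η : ℝ}

theorem sum_sum_abs_mul_maskMean_le (h : IsConversationLaw a b)
    (hw : ∑ u, Real.exp (-w u) ≤ 1) (hη : 0 < η) (c : ι → Bool) :
    ∑ j, ∑ u, |𝔼 e, a u (c ⊓ e) * boolSign (e j)| * maskMean (b u) cᶜ ≤
      Fintype.card ι * (η / 2) +
        (∑ u, maskMean (a u) c * maskMean (b u) cᶜ * w u) / η := by
  set p : 𝒰 → ℝ := fun u => maskMean (a u) c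
  set q : 𝒰 → ℝ := fun u => maskMean (b u) cᶜ
  have hp₀ (u : 𝒰) : 0 ≤ p u := h.masked.nonneg_left u c
  have hq₀ (u : 𝒰) : 0 ≤ q u := h.masked.nonneg_right u cᶜ
  have hq₁ (u : 𝒰) : q u ≤ 1 := h.masked.le_one_right u cᶜ
  have hpq : ∑ u, p u * q u = 1 := h.masked.sum_mul_eq_one c cᶜ
  have hentropy (u : 𝒰) : Real.negMulLog (p u) * q u ≤ Real.negMulLog (p u * q u) := by
    rw [Real.negMulLog_mul, mul_comm]
    exact le_add_of_nonneg_right (mul_nonneg (hp₀ u) (Real.negMulLog_nonneg (hq₀ u) (hq₁ u)))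
  calc ∑ j, ∑ u, |𝔼 e, a u (c ⊓ e) * boolSign (e j)| * q u
      = ∑ u, (∑ j, |𝔼 e, a u (c ⊓ e) * boolSign (e j)|) * q u := by
        rw [Finset.sum_comm]; simp only [Finset.sum_mul]
    _ ≤ ∑ u, (Fintype.card ι * (η / 2) * (p u * q u) + Real.negMulLog (p u * q u) / η) := by
        refine Finset.sum_le_sum fun u _ => ?_
        have hmask := h.comp (fun e => c ⊓ e) id
        have hlevel := mul_le_mul_of_nonneg_right (sum_abs_expect_mul_boolSign_le
          (hmask.nonneg_left u) (hmask.le_one_left u) hη) (hq₀ u)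
        have := div_le_div_of_nonneg_right (hentropy u) hη.le
        refine hlevel.trans ?_
        rw [add_mul, mul_assoc _ _ (q u), div_mul_eq_mul_div]
        exact add_le_add le_rfl this
    _ = Fintype.card ι * (η / 2) + (∑ u, Real.negMulLog (p u * q u)) / η := by
        rw [Finset.sum_add_distrib, ← Finset.mul_sum, hpq, mul_one, Finset.sum_div]
    _ ≤ _ := by
        gcongr _ + ?_ / _
        exact sum_negMulLog_le (fun u => mul_nonneg (hp₀ u) (hq₀ u)) hpq hw

theorem expect_sum_bitInfluence_false_le (h : IsConversationLaw a b)
    (hw : ∑ u, Real.exp (-w u) ≤ 1) (hη : 0 < η) :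
    𝔼 c, ∑ j, bitInfluence a b c j false ≤ 4 * (Fintype.card ι * (η / 2) +
      (𝔼 c, ∑ u, maskMean (a u) c * maskMean (b u) cᶜ * w u) / η) := by
  calc 𝔼 c, ∑ j, bitInfluence a b c j false = ∑ j, 𝔼 c, bitInfluence a b c j false :=
        Finset.expect_sum_comm ..
    _ ≤ ∑ j, 4 * 𝔼 c, ∑ u, |𝔼 e, a u (c ⊓ e) * boolSign (e j)| * maskMean (b u) cᶜ :=
        Finset.sum_le_sum fun j _ => h.expect_bitInfluence_false_le j
    _ = 4 * 𝔼 c, ∑ j, ∑ u, |𝔼 e, a u (c ⊓ e) * boolSign (e j)| * maskMean (b u) cᶜ := by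
        rw [← Finset.mul_sum, Finset.expect_sum_comm]
    _ ≤ 4 * 𝔼 c, (Fintype.card ι * (η / 2) +
          (∑ u, maskMean (a u) c * maskMean (b u) cᶜ * w u) / η) := by
        gcongr with c
        exact h.sum_sum_abs_mul_maskMean_le hw hη c
    _ = _ := by rw [Finset.expect_add_distrib, Fintype.expect_const, Finset.expect_div]

theorem expect_sum_bitInfluence_true_le (h : IsConversationLaw a b)
    (hw : ∑ u, Real.exp (-w u) ≤ 1) (hη : 0 < η) :
    𝔼 c, ∑ j, bitInfluence a b c j true ≤ 36 * (Fintype.card ι * (η / 2) +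
      (𝔼 c, ∑ u, maskMean (a u) c * maskMean (b u) cᶜ * w u) / η) := by
  have hswap : 𝔼 c, ∑ u, maskMean (b u) c * maskMean (a u) cᶜ * w u =
      𝔼 c, ∑ u, maskMean (a u) c * maskMean (b u) cᶜ * w u := by
    rw [← expect_compl]
    simp only [compl_compl, mul_comm (maskMean (b _) _)]
  have hleft := h.expect_sum_bitInfluence_false_le hw hη
  have hright := h.symm.expect_sum_bitInfluence_false_le hw hη
  rw [hswap] at hright
  calc 𝔼 c, ∑ j, bitInfluence a b c j true
      ≤ 𝔼 c, (6 * ∑ j, bitInfluence a b c j false + 3 * ∑ j, bitInfluence b a cᶜ j false) := by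
        refine Finset.expect_le_expect fun c _ => ?_
        rw [Finset.mul_sum, Finset.mul_sum, ← Finset.sum_add_distrib]
        exact Finset.sum_le_sum fun j _ => h.bitInfluence_true_le c j
    _ = 6 * 𝔼 c, ∑ j, bitInfluence a b c j false + 3 * 𝔼 c, ∑ j, bitInfluence b a c j false := by
        rw [Finset.expect_add_distrib, ← Finset.mul_expect, ← Finset.mul_expect,
          expect_compl (fun c => ∑ j, bitInfluence b a c j false)]
    _ ≤ _ := by linarith

end IsConversationLaw

end Masked

/-! ### The hard distribution -/

section HardDistribution

variable {κ ι : Type*}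

/-- A column of a matrix of bits: zero if `z`, and otherwise with bits set where `ρ` vanishes, hence
with probability `1 / 3` each if `ρ` is uniform. -/
def bulkColumn (z : Bool) (ρ : κ → Fin 3) : κ → Bool := fun i => !z && decide (ρ i = 0)

/-- The matrix with columns `bulkColumn (m l) (r l)`; the row `i` is the input of player `i`. -/
def bulk (m : ι → Bool) (r : ι → κ → Fin 3) : κ → ι → Bool := fun i l => bulkColumn (m l) (r l) i

/-- The matrix of bits given by the random choices `g`: a column is zero with probability `1 / 4`,
and otherwise its bits are independent and are set with probability `1 / 3`, the values for which
`expect_update_bulk` holds. -/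
def hardInput (g : ι → Fin 4 × (κ → Fin 3)) : κ → ι → Bool :=
  bulk (fun l => decide ((g l).1 = 0)) (fun l => (g l).2)

/-- Replace the column `j` of a matrix of bits. -/
def setCol [DecidableEq ι] (j : ι) (s : κ → Bool) (V : κ → ι → Bool) : κ → ι → Bool :=
  fun i => Function.update (V i) j (s i)

theorem setCol_update_bulk [DecidableEq ι] [DecidableEq κ] (j : ι) (i : κ) (v : Bool)
    (m : ι → Bool) (r : ι → κ → Fin 3) (x : ι → Bool) :
    setCol j (Function.update ⊥ i v) (Function.update (bulk m r) i x) =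
      Function.update (bulk (Function.update m j true) r) i (Function.update x j v) := by
  funext i' l
  by_cases hi : i' = i
  · subst hi; simp [setCol]
  · by_cases hl : l = j
    · subst hl; simp [setCol, hi, bulk, bulkColumn]
    · simp [setCol, hi, bulk, hl]

theorem bulkColumn_true (ρ : κ → Fin 3) : bulkColumn true ρ = ⊥ := rfl

section Column

variable [Fintype κ] [DecidableEq κ]

theorem expect_bulkColumn_false (i : κ) (ψ : (κ → Bool) → ℝ) :
    𝔼 ρ, ψ (bulkColumn false ρ) = 1 / 3 * 𝔼 ρ, ψ (Function.update (bulkColumn false ρ) i true) +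
      2 / 3 * 𝔼 ρ, ψ (Function.update (bulkColumn false ρ) i false) := by
  have hupd (ρ : κ → Fin 3) (s : Fin 3) : bulkColumn false (Function.update ρ i s) =
      Function.update (bulkColumn false ρ) i (decide (s = 0)) := by
    funext i'
    by_cases hi : i' = i
    · subst hi; simp [bulkColumn]
    · simp [bulkColumn, hi]
  rw [← expect_expect_update i, Finset.mul_expect, Finset.mul_expect, ← Finset.expect_add_distrib]
  refine Finset.expect_congr rfl fun ρ _ => ?_
  simp only [hupd, Fintype.expect_eq_sum_div_card, Fin.sum_univ_three, Fintype.card_fin]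
  simp
  ring

theorem expect_hardColumn (ψ : (κ → Bool) → ℝ) :
    𝔼 p : Fin 4 × (κ → Fin 3), ψ (bulkColumn (decide (p.1 = 0)) p.2) =
      3 / 4 * 𝔼 ρ, ψ (bulkColumn false ρ) + 1 / 4 * ψ ⊥ := by
  rw [← expect_expect fun z ρ => ψ (bulkColumn (decide (z = (0 : Fin 4))) ρ),
    Fintype.expect_eq_sum_div_card, Fin.sum_univ_four]
  simp [bulkColumn_true]
  ring

theorem expect_playerColumn (i : κ) (ψ : (κ → Bool) → ℝ) :
    𝔼 p : Bool × Bool × Bool × (κ → Fin 3),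
      ψ (Function.update (bulkColumn (!p.1 && p.2.2.1) p.2.2.2) i (p.1 && p.2.1)) =
    1 / 4 * 𝔼 ρ, ψ (Function.update (bulkColumn false ρ) i true) +
      1 / 2 * 𝔼 ρ, ψ (Function.update (bulkColumn false ρ) i false) + 1 / 4 * ψ ⊥ := by
  have hzero : Function.update (⊥ : κ → Bool) i false = ⊥ := Function.update_eq_self i _
  simp only [expect_bool_prod, Bool.not_true, Bool.not_false, Bool.true_and, Bool.false_and,
    bulkColumn_true, hzero, Fintype.expect_const]
  ring

end Column

variable [Fintype κ] [DecidableEq κ] [Fintype ι] [DecidableEq ι]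

/-- The average over the hard distribution of inputs `hardInput g`. -/
noncomputable def hardMean (φ : (κ → ι → Bool) → ℝ) : ℝ :=
  𝔼 g : ι → Fin 4 × (κ → Fin 3), φ (hardInput g)

theorem hardMean_mono {φ ψ : (κ → ι → Bool) → ℝ} (h : φ ≤ ψ) : hardMean φ ≤ hardMean ψ :=
  Finset.expect_le_expect fun _ _ => h _

theorem hardMean_sum {α : Type*} (s : Finset α) (φ : α → (κ → ι → Bool) → ℝ) :
    hardMean (fun V => ∑ x ∈ s, φ x V) = ∑ x ∈ s, hardMean (φ x) :=
  Finset.expect_sum_comm ..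

theorem hardMean_const (a : ℝ) : hardMean (fun _ : κ → ι → Bool => a) = a :=
  Fintype.expect_const a

/-- In the hard distribution the input of player `i` is a random subset of `c`, and the columns of
the others are zero on a random subset of the complement of `c`, for a random set `c`: given `c`,
the two are independent. -/
theorem expect_update_bulk (i : κ) (φ : (κ → ι → Bool) → ℝ) :
    𝔼 c : ι → Bool, 𝔼 e : ι → Bool, 𝔼 e' : ι → Bool, 𝔼 r : ι → κ → Fin 3,
      φ (Function.update (bulk (cᶜ ⊓ e') r) i (c ⊓ e)) = hardMean φ := by
  have hcolumn (g : ι → Bool × Bool × Bool × (κ → Fin 3)) :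
      Function.update (bulk ((fun l => (g l).1)ᶜ ⊓ fun l => (g l).2.2.1) fun l => (g l).2.2.2) i
        ((fun l => (g l).1) ⊓ fun l => (g l).2.1) = fun i' l =>
      Function.update (bulkColumn (!(g l).1 && (g l).2.2.1) (g l).2.2.2) i
        ((g l).1 && (g l).2.1) i' := by
    funext i' l
    by_cases hi : i' = i
    · subst hi; simp
    · simp [hi, bulk]
  simp only [expect_expect_arrow, hcolumn]
  refine expect_arrow_congr
    (fun p : Bool × Bool × Bool × (κ → Fin 3) =>
      Function.update (bulkColumn (!p.1 && p.2.2.1) p.2.2.2) i (p.1 && p.2.1))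
    (fun p : Fin 4 × (κ → Fin 3) => bulkColumn (decide (p.1 = 0)) p.2) (fun ψ => ?_)
    (fun W => φ fun i l => W l i)
  rw [expect_playerColumn, expect_hardColumn, expect_bulkColumn_false i]
  ring

end HardDistribution

section ListWeight

/-- Since there are `2 ^ L` lists of length `L`, the weights `exp (-listWeight u)` sum to at
most `1`. -/
noncomputable def listWeight (u : List Bool) : ℝ := (2 * u.length + 1) * Real.log 2

theorem exp_neg_listWeight (u : List Bool) :
    Real.exp (-listWeight u) = (1 / 2) ^ (2 * u.length + 1) := by
  have hpos : Real.exp (listWeight u) = 2 ^ (2 * u.length + 1) := by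
    rw [listWeight, mul_comm, Real.exp_mul, Real.exp_log two_pos]
    exact_mod_cast Real.rpow_natCast (2 : ℝ) (2 * u.length + 1)
  rw [Real.exp_neg, hpos, one_div, inv_pow]

theorem card_filter_length_eq_le {α : Type*} [Fintype α] (F : Finset (List α)) (L : ℕ) :
    (F.filter fun u => u.length = L).card ≤ Fintype.card α ^ L := by
  rw [← card_vector, ← Fintype.card_coe]
  exact Fintype.card_le_of_injective
    (fun u => (⟨u.1, (Finset.mem_filter.1 u.2).2⟩ : List.Vector α L))
    fun u v h => Subtype.ext (congrArg (fun w : List.Vector α L => w.1) h)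

theorem sum_exp_neg_listWeight_le (F : Finset (List Bool)) :
    ∑ u ∈ F, Real.exp (-listWeight u) ≤ 1 := by
  have hlength (L : ℕ) :
      ∑ u ∈ F.filter (fun u => u.length = L), Real.exp (-listWeight u) ≤ (1 / 2) ^ L * (1 / 2) := by
    calc ∑ u ∈ F.filter (fun u => u.length = L), Real.exp (-listWeight u)
        = (F.filter fun u => u.length = L).card * ((1 : ℝ) / 2) ^ (2 * L + 1) := by
          rw [← nsmul_eq_mul, ← Finset.sum_const]
          refine Finset.sum_congr rfl fun u hu => ?_
          rw [exp_neg_listWeight, (Finset.mem_filter.1 hu).2]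
      _ ≤ 2 ^ L * ((1 : ℝ) / 2) ^ (2 * L + 1) := by
          gcongr; exact_mod_cast card_filter_length_eq_le F L
      _ = (1 / 2) ^ L * (1 / 2) := by
          rw [pow_succ, pow_mul, ← mul_assoc, ← mul_pow]
          norm_num
  set N := F.sup List.length
  have hmaps (u : List Bool) (hu : u ∈ F) : u.length ∈ Finset.range (N + 1) :=
    Finset.mem_range.2 (Nat.lt_succ_of_le (Finset.le_sup (f := List.length) hu))
  calc ∑ u ∈ F, Real.exp (-listWeight u)
      ≤ ∑ L ∈ Finset.range (N + 1), ((1 : ℝ) / 2) ^ L * (1 / 2) := by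
        rw [← Finset.sum_fiberwise_of_maps_to hmaps]
        exact Finset.sum_le_sum fun L _ => hlength L
    _ = 1 - (1 / 2) ^ (N + 1) := by
        rw [← Finset.sum_mul, geom_sum_eq (by norm_num)]
        ring
    _ ≤ 1 := sub_le_self _ (by positivity)

end ListWeight

section Rectangular

variable {X W S : Type*}

/-- The fibres of `u` are rectangles, as are the fibres of the conversation of one party, with input
`x` and fixed coins, with the rest of the world, described by `w`. -/
def IsRectangular (u : X → W → S) : Prop :=
  ∀ x x' w w', u x w = u x' w' → u x w' = u x' w'

open Classical in
/-- The indicator of the rows met by the fibre of `u` over `s`. -/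
noncomputable def rowIndicator (u : X → W → S) (s : S) (x : X) : ℝ :=
  if ∃ w, u x w = s then 1 else 0

open Classical in
/-- The common value of `g x w` at the points `(x, w)` of the fibre of `u` over `s`, when `g x w` is
a function of `u x w` and `w`; zero if there is no such `x`. For `g = 1` this is the indicator of
the columns met by the fibre. -/
noncomputable def colValue (u : X → W → S) (g : X → W → ℝ) (s : S) (w : W) : ℝ :=
  if h : ∃ x, u x w = s then g h.choose w else 0

variable {u : X → W → S} {g g' : X → W → ℝ}

theorem rowIndicator_nonneg : 0 ≤ rowIndicator u := fun s x => by
  change 0 ≤ rowIndicator u s x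
  rw [rowIndicator]; split_ifs <;> norm_num

theorem rowIndicator_le_one : rowIndicator u ≤ 1 := fun s x => by
  change rowIndicator u s x ≤ 1
  rw [rowIndicator]; split_ifs <;> norm_num

theorem colValue_mono (h : g ≤ g') : colValue u g ≤ colValue u g' := fun s w => by
  change colValue u g s w ≤ colValue u g' s w
  rw [colValue, colValue]
  split_ifs
  · exact h _ _
  · exact le_rfl

theorem colValue_nonneg (h : 0 ≤ g) : 0 ≤ colValue u g := by
  refine (le_of_eq ?_).trans (colValue_mono h)
  funext s w
  simp [colValue]

theorem colValue_le_one (h : g ≤ 1) : colValue u g ≤ 1 := fun s w => by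
  change colValue u g s w ≤ 1
  rw [colValue]
  split_ifs
  · exact h _ _
  · exact zero_le_one

theorem IsRectangular.rowIndicator_mul_colValue [DecidableEq S] (hu : IsRectangular u)
    (hg : ∀ x x' w, u x w = u x' w → g x w = g x' w) (s : S) (x : X) (w : W) :
    rowIndicator u s x * colValue u g s w = if u x w = s then g x w else 0 := by
  by_cases hs : u x w = s
  · have hcol : ∃ x', u x' w = s := ⟨x, hs⟩
    rw [rowIndicator, colValue, if_pos ⟨w, hs⟩, dif_pos hcol, if_pos hs, one_mul]
    exact hg _ _ _ (hcol.choose_spec.trans hs.symm)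
  · rw [if_neg hs, rowIndicator, colValue]
    split_ifs with hrow hcol
    · obtain ⟨w', hw'⟩ := hrow
      obtain ⟨x', hx'⟩ := hcol
      exact absurd ((hu x x' w' w (hw'.trans hx'.symm)).trans hx') hs
    all_goals simp

variable [Fintype S]

theorem IsRectangular.sum_rowIndicator_mul_colValue_mul (hu : IsRectangular u)
    (hg : ∀ x x' w, u x w = u x' w → g x w = g x' w) (φ : S → ℝ) (x : X) (w : W) :
    ∑ s, rowIndicator u s x * colValue u g s w * φ s = g x w * φ (u x w) := by
  classical
  simp [hu.rowIndicator_mul_colValue hg]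

theorem IsRectangular.isConversationLaw (hu : IsRectangular u) :
    IsConversationLaw (rowIndicator u) (colValue u 1) where
  nonneg_left u := rowIndicator_nonneg u
  le_one_left u := rowIndicator_le_one u
  nonneg_right u := colValue_nonneg (fun _ _ => zero_le_one) u
  le_one_right u := colValue_le_one le_rfl u
  sum_mul_eq_one x y := by
    simpa using hu.sum_rowIndicator_mul_colValue_mul (g := 1) (fun _ _ _ _ => rfl) 1 x y

theorem IsRectangular.abs_expect_sub_expect_le {E R : Type*} [Fintype E] [Fintype R]
    (hu : IsRectangular u) (hg : ∀ x x' w, u x w = u x' w → g x w = g x' w) (hg₀ : 0 ≤ g)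
    (hg₁ : g ≤ 1) (x₀ x₁ : E → X) (w : R → W) :
    |𝔼 e, 𝔼 r, g (x₁ e) (w r) - 𝔼 e, 𝔼 r, g (x₀ e) (w r)| ≤
      ∑ s, |𝔼 e, rowIndicator u s (x₁ e) - 𝔼 e, rowIndicator u s (x₀ e)| *
        𝔼 r, colValue u 1 s (w r) := by
  have hsplit (x : E → X) : 𝔼 e, 𝔼 r, g (x e) (w r) =
      ∑ s, (𝔼 e, rowIndicator u s (x e)) * 𝔼 r, colValue u g s (w r) := by
    have hpoint (x : X) (w : W) : g x w = ∑ s, rowIndicator u s x * colValue u g s w := by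
      simpa using (hu.sum_rowIndicator_mul_colValue_mul hg 1 x w).symm
    simp only [hpoint, Finset.expect_sum_comm, ← Finset.mul_expect, ← Finset.expect_mul]
  rw [hsplit, hsplit, ← Finset.sum_sub_distrib]
  refine (Finset.abs_sum_le_sum_abs _ _).trans (Finset.sum_le_sum fun s _ => ?_)
  have hcol₀ : 0 ≤ 𝔼 r, colValue u g s (w r) :=
    Finset.expect_nonneg fun r _ => colValue_nonneg hg₀ s (w r)
  rw [← sub_mul, abs_mul, abs_of_nonneg hcol₀]
  gcongr with r
  exact colValue_mono hg₁ s (w r)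

end Rectangular

section PlayerInfluence

variable {κ 𝒯 : Type*} [DecidableEq κ]

/-- The input of player `i` may be exchanged for any other one under which its conversation `u` is
the same, without changing the outcome `T`. -/
def CutAndPaste {In S : Type*} (T : (κ → In) → 𝒯) (u : 𝒯 → S) (i : κ) : Prop :=
  ∀ X X', u (T X) = u (T X') → T (Function.update X' i (X i)) = T X'

theorem CutAndPaste.update_eq_update {In S : Type*} {T : (κ → In) → 𝒯} {u : 𝒯 → S} {i : κ}
    (h : CutAndPaste T u i) {x x' : In} {W W' : κ → In}
    (hu : u (T (Function.update W i x)) = u (T (Function.update W' i x'))) :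
    T (Function.update W' i x) = T (Function.update W' i x') := by
  simpa using h _ _ hu

variable {ι : Type*} [Fintype κ] [Fintype ι] [DecidableEq ι]

theorem IsRectangular.hardMean_eq {S : Type*} [Fintype S] {u : (ι → Bool) → (κ → ι → Bool) → S}
    (hu : IsRectangular u) (i : κ) {ψ : (κ → ι → Bool) → ℝ} {φ : S → ℝ}
    (hψ : ∀ x W, ψ (Function.update W i x) = φ (u x W)) :
    hardMean ψ = 𝔼 c, ∑ s, maskMean (rowIndicator u s) c *
      maskMean (fun m => 𝔼 r, colValue u 1 s (bulk m r)) cᶜ * φ s := by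
  have hpoint (x : ι → Bool) (W : κ → ι → Bool) : ψ (Function.update W i x) =
      ∑ s, rowIndicator u s x * colValue u 1 s W * φ s := by
    simpa [hψ] using (hu.sum_rowIndicator_mul_colValue_mul (g := 1) (fun _ _ _ _ => rfl)
      φ x W).symm
  simp only [← expect_update_bulk i, hpoint, Finset.expect_sum_comm, maskMean,
    ← Finset.mul_expect, ← Finset.expect_mul]

/-- One bit of the input of a player who says little has little influence on the outcome. -/
theorem sum_abs_hardMean_setCol_le {T : (κ → ι → Bool) → 𝒯} {u : 𝒯 → List Bool} {i : κ}
    (hT : CutAndPaste T u i) {G : ι → 𝒯 → ℝ} (hG₀ : 0 ≤ G) (hG₁ : G ≤ 1) {η : ℝ} (hη : 0 < η) :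
    ∑ j, |hardMean (fun V => G j (T (setCol j (Function.update ⊥ i true) V))) -
        hardMean (fun V => G j (T (setCol j (Function.update ⊥ i false) V)))| ≤
      36 * (Fintype.card ι * (η / 2) + hardMean (fun V => listWeight (u (T V))) / η) := by
  classical
  set F : Finset (List Bool) := Finset.univ.image fun V => u (T V)
  set v : (ι → Bool) → (κ → ι → Bool) → F := fun x W =>
    ⟨u (T (Function.update W i x)), Finset.mem_image_of_mem _ (Finset.mem_univ _)⟩
  have hpaste {x x' W W'} (h : v x W = v x' W') :
      T (Function.update W' i x) = T (Function.update W' i x') :=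
    hT.update_eq_update (congrArg Subtype.val h)
  have hv : IsRectangular v := fun x x' W W' h => Subtype.ext (congrArg u (hpaste h))
  have hlaw := hv.isConversationLaw.expect_right.comp id
    fun (m : ι → Bool) (r : ι → κ → Fin 3) => bulk m r
  have hweight : ∑ s : F, Real.exp (-listWeight s) ≤ 1 := by
    rw [Finset.sum_coe_sort F fun s => Real.exp (-listWeight s)]
    exact sum_exp_neg_listWeight_le F
  rw [hv.hardMean_eq (φ := fun s => listWeight s) i fun _ _ => rfl]
  refine le_trans ?_ (hlaw.expect_sum_bitInfluence_true_le hweight hη)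
  rw [Finset.expect_sum_comm]
  refine Finset.sum_le_sum fun j _ => ?_
  rw [← expect_update_bulk i, ← expect_update_bulk i, ← Finset.expect_sub_distrib]
  refine (Finset.abs_expect_le _ _).trans (Finset.expect_le_expect fun c _ => ?_)
  have hsame (x x' W) (h : v x W = v x' W) :
      G j (T (Function.update W i x)) = G j (T (Function.update W i x')) :=
    congrArg (G j) (hpaste h)
  simpa only [setCol_update_bulk, bitInfluence, maskMeanAt, maskMean, expect_expect, id] using
    hv.abs_expect_sub_expect_le hsame (fun _ _ => hG₀ j _) (fun _ _ => hG₁ j _)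
      (fun e => Function.update (c ⊓ e) j false) (fun e => Function.update (c ⊓ e) j true)
      (fun p : (ι → Bool) × (ι → κ → Fin 3) => bulk (Function.update (cᶜ ⊓ p.1) j true) p.2)

end PlayerInfluence

/-! ### The lower bound for task allocation -/

theorem CutAndPaste.comp {κ In In' 𝒯 S : Type*} [DecidableEq κ] {T : (κ → In) → 𝒯} {u : 𝒯 → S}
    {i : κ} (hT : CutAndPaste T u i) (f : κ → In' → In) :
    CutAndPaste (fun X => T fun i' => f i' (X i')) u i := fun X X' h => by
  simp only [Function.apply_update fun i' => f i']
  exact hT _ _ h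

section Owner

variable {κ ι 𝒯 : Type*} [DecidableEq κ] [DecidableEq ι]

/-- Give the task `l` to the player `Z l`, in addition to the tasks in `V`. -/
def orOwner (Z : ι → κ) (V : κ → ι → Bool) : κ → ι → Bool := fun i l => V i l || decide (Z l = i)

theorem orOwner_setCol_update (Z : ι → κ) (V : κ → ι → Bool) (i : κ) (j : ι) :
    orOwner Z (setCol j (Function.update ⊥ i true) V) =
      orOwner (Function.update Z j i) (setCol j (Function.update ⊥ (Z j) true) V) := by
  funext i' l
  by_cases h : l = j
  · subst h
    simp [orOwner, setCol, Function.update_apply, Bool.or_comm, eq_comm]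
  · simp [orOwner, setCol, h]

variable [Fintype κ] [Fintype ι]

/-- The probability that the player `y` is assigned to the task `j`, in addition to whose owner
`Z j` the players in `s` can perform `j`, when the other columns come from the hard distribution. -/
noncomputable def foundProb (Y : (κ → ι → Bool) → ι → Option κ) (Z : ι → κ) (j : ι) (s : κ → Bool)
    (y : κ) : ℝ :=
  hardMean fun V => if Y (orOwner Z (setCol j s V)) j = some y then 1 else 0

/-- If two players can perform a task, it does not matter which of them is called its owner. -/
theorem expect_foundProb_owner (Y : (κ → ι → Bool) → ι → Option κ) (j : ι) :
    𝔼 i, 𝔼 Z : ι → κ, foundProb Y Z j (Function.update ⊥ i true) (Z j) =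
      𝔼 i, 𝔼 Z : ι → κ, foundProb Y Z j (Function.update ⊥ i true) i := by
  have hinv : Function.Involutive
      (fun p : κ × (ι → κ) => (p.2 j, Function.update p.2 j p.1)) := by
    intro p; simp
  rw [expect_expect, expect_expect]
  refine Fintype.expect_equiv hinv.toPerm _ _ fun p => ?_
  change _ = foundProb Y (Function.update p.2 j p.1) j (Function.update ⊥ (p.2 j) true) (p.2 j)
  simp only [foundProb, orOwner_setCol_update p.2]

theorem sum_foundProb_le (Y : (κ → ι → Bool) → ι → Option κ) (Z : ι → κ) (j : ι) (s : κ → Bool) :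
    ∑ i, foundProb Y Z j s i ≤ 1 := by
  simp only [foundProb]
  rw [← hardMean_sum]
  refine (hardMean_mono (ψ := fun _ => 1) fun V => ?_).trans_eq (hardMean_const _)
  rcases Y (orOwner Z (setCol j s V)) j with _ | y <;> simp

theorem expect_foundProb_bot_le [Nonempty κ] (Y : (κ → ι → Bool) → ι → Option κ) (j : ι) :
    𝔼 Z : ι → κ, foundProb Y Z j ⊥ (Z j) ≤ 1 / Fintype.card κ +
      𝔼 i, 𝔼 Z : ι → κ,
        |foundProb Y Z j (Function.update ⊥ i true) (Z j) - foundProb Y Z j ⊥ (Z j)| +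
      𝔼 i, 𝔼 Z : ι → κ, |foundProb Y Z j (Function.update ⊥ i true) i - foundProb Y Z j ⊥ i| := by
  have hfresh : 𝔼 i, 𝔼 Z : ι → κ, foundProb Y Z j ⊥ i ≤ 1 / Fintype.card κ := by
    rw [Finset.expect_comm]
    refine Finset.expect_le Finset.univ_nonempty fun Z _ => ?_
    rw [Fintype.expect_eq_sum_div_card]
    gcongr
    exact sum_foundProb_le Y Z j ⊥
  have hadd : 𝔼 Z : ι → κ, foundProb Y Z j ⊥ (Z j) ≤
      𝔼 i, 𝔼 Z : ι → κ, foundProb Y Z j (Function.update ⊥ i true) (Z j) +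
      𝔼 i, 𝔼 Z : ι → κ,
        |foundProb Y Z j (Function.update ⊥ i true) (Z j) - foundProb Y Z j ⊥ (Z j)| := by
    rw [← Finset.expect_add_distrib]
    refine Finset.le_expect Finset.univ_nonempty fun i _ => ?_
    rw [← Finset.expect_add_distrib]
    exact Finset.expect_le_expect fun Z _ => by
      linarith [neg_abs_le
        (foundProb Y Z j (Function.update ⊥ i true) (Z j) - foundProb Y Z j ⊥ (Z j))]
  have hremove : 𝔼 i, 𝔼 Z : ι → κ, foundProb Y Z j (Function.update ⊥ i true) i ≤
      𝔼 i, 𝔼 Z : ι → κ, foundProb Y Z j ⊥ i +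
      𝔼 i, 𝔼 Z : ι → κ, |foundProb Y Z j (Function.update ⊥ i true) i - foundProb Y Z j ⊥ i| := by
    simp only [← Finset.expect_add_distrib]
    exact Finset.expect_le_expect fun i _ => Finset.expect_le_expect fun Z _ => by
      linarith [le_abs_self (foundProb Y Z j (Function.update ⊥ i true) i - foundProb Y Z j ⊥ i)]
  rw [expect_foundProb_owner] at hadd
  linarith

theorem sum_hardMean_listWeight_le {u : κ → (κ → ι → Bool) → List Bool} {C : ℕ}
    (hC : ∀ V, ∑ i, (u i V).length ≤ C) :
    ∑ i, hardMean (fun V => listWeight (u i V)) ≤ 2 * C + Fintype.card κ := by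
  rw [← hardMean_sum]
  refine (hardMean_mono (ψ := fun _ => 2 * C + Fintype.card κ) fun V => ?_).trans_eq
    (hardMean_const _)
  have hlength : (∑ i, ((u i V).length : ℝ)) ≤ C := by exact_mod_cast hC V
  have hlog : Real.log 2 ≤ 1 := by linarith [Real.log_two_lt_d9]
  calc ∑ i, listWeight (u i V) = (2 * ∑ i, ((u i V).length : ℝ) + Fintype.card κ) * Real.log 2 := by
        simp [listWeight, ← Finset.sum_mul, Finset.sum_add_distrib, ← Finset.mul_sum]
    _ ≤ (2 * ∑ i, ((u i V).length : ℝ) + Fintype.card κ) * 1 := by gcongr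
    _ ≤ 2 * C + Fintype.card κ := by linarith

variable {T : (κ → ι → Bool) → 𝒯} {ch : κ → 𝒯 → List Bool} {C : ℕ} {η : ℝ}

theorem sum_abs_foundProb_sub_le (hT : ∀ i, CutAndPaste T (ch i) i) (hη : 0 < η)
    (Y : 𝒯 → ι → Option κ) (Z : ι → κ) (i : κ) (y : ι → κ) :
    ∑ j, |foundProb (Y ∘ T) Z j (Function.update ⊥ i true) (y j) -
        foundProb (Y ∘ T) Z j ⊥ (y j)| ≤
      36 * (Fintype.card ι * (η / 2) +
        hardMean (fun V => listWeight (ch i (T (orOwner Z V)))) / η) := by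
  have hbot : Function.update (⊥ : κ → Bool) i false = ⊥ := Function.update_eq_self i _
  have h := sum_abs_hardMean_setCol_le
    ((hT i).comp fun i' x l => x l || decide (Z l = i'))
    (G := fun j t => if Y t j = some (y j) then 1 else 0)
    (fun j t => by change (0 : ℝ) ≤ ite _ _ _; split_ifs <;> norm_num)
    (fun j t => by change ite _ _ _ ≤ (1 : ℝ); split_ifs <;> norm_num) hη
  simp only [hbot] at h
  exact h

theorem expect_sum_abs_foundProb_sub_le [Nonempty κ] (hT : ∀ i, CutAndPaste T (ch i) i)
    (hC : ∀ X, ∑ i, (ch i (T X)).length ≤ C) (hη : 0 < η) (Y : 𝒯 → ι → Option κ)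
    (y : κ → (ι → κ) → ι → κ) :
    𝔼 i, 𝔼 Z : ι → κ, ∑ j, |foundProb (Y ∘ T) Z j (Function.update ⊥ i true) (y i Z j) -
        foundProb (Y ∘ T) Z j ⊥ (y i Z j)| ≤
      36 * (Fintype.card ι * (η / 2) + (2 * C + Fintype.card κ) / (Fintype.card κ * η)) := by
  rw [Finset.expect_comm]
  refine Finset.expect_le Finset.univ_nonempty fun Z _ => ?_
  refine (Finset.expect_le_expect fun i _ =>
    sum_abs_foundProb_sub_le hT hη Y Z i (y i Z)).trans ?_
  rw [← Finset.mul_expect, Finset.expect_add_distrib, Fintype.expect_const,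
    Fintype.expect_eq_sum_div_card, ← Finset.sum_div, div_div, mul_comm η]
  gcongr
  exact sum_hardMean_listWeight_le fun V => hC _

/-- If a task is given only to its random owner, then this owner is rarely found: telling a random
player of the task makes little difference, and then the two are interchangeable; but without
being told, this player is assigned to the task with probability at most `1 / k`. -/
theorem expect_expect_foundProb_bot_le [Nonempty κ] [Nonempty ι]
    (hT : ∀ i, CutAndPaste T (ch i) i) (hC : ∀ X, ∑ i, (ch i (T X)).length ≤ C) (hη : 0 < η)
    (Y : 𝒯 → ι → Option κ) :
    𝔼 j, 𝔼 Z : ι → κ, foundProb (Y ∘ T) Z j ⊥ (Z j) ≤ 1 / Fintype.card κ +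
      72 * (η / 2 + (2 * C + Fintype.card κ) / (Fintype.card κ * η * Fintype.card ι)) := by
  set D : ℝ := η / 2 + (2 * C + Fintype.card κ) / (Fintype.card κ * η * Fintype.card ι) with hD
  have hinfluence (y : κ → (ι → κ) → ι → κ) :
      𝔼 j, 𝔼 i, 𝔼 Z : ι → κ, |foundProb (Y ∘ T) Z j (Function.update ⊥ i true) (y i Z j) -
        foundProb (Y ∘ T) Z j ⊥ (y i Z j)| ≤ 36 * D := by
    rw [Fintype.expect_eq_sum_div_card, div_le_iff₀ (by positivity)]
    simp only [← Finset.expect_sum_comm]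
    refine (expect_sum_abs_foundProb_sub_le hT hC hη Y y).trans_eq ?_
    rw [hD]; field_simp
  refine (Finset.expect_le_expect fun j _ => expect_foundProb_bot_le (Y ∘ T) j).trans ?_
  rw [Finset.expect_add_distrib, Finset.expect_add_distrib, Fintype.expect_const]
  linarith [hinfluence fun _ Z j => Z j, hinfluence fun i _ _ => i]

end Owner

section Protocol

theorem le_expect_measureReal {Ω α : Type*} [MeasurableSpace Ω] (μ : Measure Ω)
    [IsProbabilityMeasure μ] [Fintype α] (F : α → Set Ω) {s : ℝ}
    (h : ∀ ω, s ≤ 𝔼 a, (F a).indicator 1 ω) : s ≤ 𝔼 a, μ.real (F a) := by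
  have hmeas (a : α) : MeasurableSet (toMeasurable μ (F a)) := measurableSet_toMeasurable _ _
  have hint (a : α) : Integrable ((toMeasurable μ (F a)).indicator (1 : Ω → ℝ)) μ :=
    (integrable_indicator_iff (hmeas a)).2 integrableOn_const
  calc s = ∫ _, s ∂μ := by simp
    _ ≤ ∫ ω, (∑ a, (toMeasurable μ (F a)).indicator (1 : Ω → ℝ) ω) / Fintype.card α ∂μ := by
        refine integral_mono (integrable_const _)
          ((integrable_finsetSum _ fun a _ => hint a).div_const _) fun ω => (h ω).trans ?_
        rw [Fintype.expect_eq_sum_div_card]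
        gcongr with a
        · exact zero_le_one
        · exact subset_toMeasurable μ (F a)
    _ = 𝔼 a, μ.real (F a) := by
        rw [integral_div, integral_finsetSum _ fun a _ => hint a, Fintype.expect_eq_sum_div_card]
        simp only [integral_indicator_one (hmeas _), measureReal_def, measure_toMeasurable]

variable {k n : ℕ}

theorem Protocol.cutAndPaste_exec {In Out : Type} (P : Protocol k In Out) (ρ : P.Coins) (m : ℕ)
    (i : Fin k) : CutAndPaste (fun X => P.exec X ρ m) (channel i) i :=
  fun _ _ h => P.exec_update_of_channel_eq h le_rfl

/-- The input in which player `i` can perform the tasks marked in the row `V i`. -/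
def taskSets (V : Fin k → Fin n → Bool) : Fin k → Finset (Fin n) :=
  fun i => Finset.univ.filter fun l => V i l = true

theorem mem_taskSets_orOwner_setCol_bot {Z : Fin n → Fin k} {j : Fin n} {V : Fin k → Fin n → Bool}
    {i : Fin k} : j ∈ taskSets (orOwner Z (setCol j ⊥ V)) i ↔ Z j = i := by
  simp [taskSets, orOwner, setCol]

/-- The player whom the coordinator assigns to the task `j` after the transcript `τ`. -/
def Protocol.assigned (P : Protocol k (Finset (Fin n)) (Fin n → Fin k)) (ρ : P.Coins)
    (τ : Transcript k) (j : Fin n) : Option (Fin k) :=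
  (P.coord ρ.1 τ).getLeft?.map fun y => y j

theorem Protocol.assigned_exec_eq_owner {P : Protocol k (Finset (Fin n)) (Fin n → Fin k)} {C : ℕ}
    (hC : P.cost ≤ C) {ρ : P.Coins} {Z : Fin n → Fin k} {j : Fin n} {V : Fin k → Fin n → Bool}
    (h : ∃ τ y, P.Ends (taskSets (orOwner Z (setCol j ⊥ V))) ρ τ y ∧
      (taskAllocation n k).correct (taskSets (orOwner Z (setCol j ⊥ V))) y) :
    P.assigned ρ (P.exec (taskSets (orOwner Z (setCol j ⊥ V))) ρ (C + 1)) j = some (Z j) := by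
  obtain ⟨τ, y, hends, hcorrect⟩ := h
  obtain ⟨y', hends'⟩ := P.exists_ends_exec hC (taskSets (orOwner Z (setCol j ⊥ V))) ρ
  obtain ⟨rfl, rfl⟩ := hends.unique hends'
  have howner : Z j = y j := mem_taskSets_orOwner_setCol_bot.1 (hcorrect j)
  simp [assigned, (P.next_eq_inl_iff.1 hends.2).2, howner]

theorem Protocol.expect_foundProb_assigned_le [NeZero k] [NeZero n]
    (P : Protocol k (Finset (Fin n)) (Fin n → Fin k)) {C : ℕ} (hC : P.cost ≤ C) {η : ℝ}
    (hη : 0 < η) (ρ : P.Coins) :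
    𝔼 j, 𝔼 Z : Fin n → Fin k,
      foundProb (fun V => P.assigned ρ (P.exec (taskSets V) ρ (C + 1))) Z j ⊥ (Z j) ≤
    1 / k + 72 * (η / 2 + (2 * C + k) / (k * η * n)) := by
  have hlength (X : Fin k → Fin n → Bool) :
      ∑ i, (channel i (P.exec (taskSets X) ρ (C + 1))).length ≤ C := by
    rw [sum_length_channel]
    exact_mod_cast (P.length_exec_le_cost _ _ _).trans hC
  have h := expect_expect_foundProb_bot_le (fun i => (P.cutAndPaste_exec ρ (C + 1) i).comp
    fun _ (x : Fin n → Bool) => Finset.univ.filter fun l => x l = true) hlength hη (P.assigned ρ)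
  simp only [Fintype.card_fin] at h
  exact h

theorem Protocol.Solves.one_sub_le [NeZero k] [NeZero n]
    {P : Protocol k (Finset (Fin n)) (Fin n → Fin k)} {δ : ℝ} (hδ : 0 ≤ δ)
    (hP : P.Solves (taskAllocation n k) δ) {C : ℕ} (hC : P.cost ≤ C) {η : ℝ} (hη : 0 < η) :
    1 - δ ≤ 1 / k + 72 * (η / 2 + (2 * C + k) / (k * η * n)) := by
  classical
  set X : Fin n × (Fin n → Fin k) × (Fin n → Fin 4 × (Fin k → Fin 3)) → Fin k → Finset (Fin n) :=
    fun a => taskSets (orOwner a.2.1 (setCol a.1 ⊥ (hardInput a.2.2)))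
  set fails : Fin n × (Fin n → Fin k) × (Fin n → Fin 4 × (Fin k → Fin 3)) → Set P.Coins :=
    fun a => {ρ | ¬ ∃ τ y, P.Ends (X a) ρ τ y ∧ (taskAllocation n k).correct (X a) y}
  have hfails (a) : P.law.real (fails a) ≤ δ :=
    ENNReal.toReal_le_of_le_ofReal hδ <| hP _ fun l => ⟨a.2.1 l, by simp [X, taskSets, orOwner]⟩
  suffices h : 1 - (1 / k + 72 * (η / 2 + (2 * C + k) / (k * η * n))) ≤ 𝔼 a, P.law.real (fails a) by
    linarith [h.trans (Finset.expect_le Finset.univ_nonempty fun a _ => hfails a)]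
  refine le_expect_measureReal P.law fails fun ρ => ?_
  have hpoint (a) : 1 - (if P.assigned ρ (P.exec (X a) ρ (C + 1)) a.1 = some (a.2.1 a.1)
      then (1 : ℝ) else 0) ≤ (fails a).indicator 1 ρ := by
    by_cases h : ρ ∈ fails a
    · rw [Set.indicator_of_mem h]
      split_ifs <;> simp
    · rw [Set.indicator_of_notMem h, if_pos (Protocol.assigned_exec_eq_owner hC (not_not.1 h)),
        sub_self]
  refine le_trans ?_ (Finset.expect_le_expect fun a _ => hpoint a)
  rw [Finset.expect_sub_distrib, Fintype.expect_const]
  refine sub_le_sub_left (le_of_eq_of_le ?_ (P.expect_foundProb_assigned_le hC hη ρ)) 1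
  simp only [foundProb, hardMean, expect_expect]
  rfl

end Protocol

/-- In `h` the parameter `η` of the influence bound is `ε / 180`, so that the terms that do not
involve `C` are at most `ε / 5` each. -/
theorem mul_le_of_le_one_div_add {ε k n C : ℝ} (hε : 0 < ε) (hk : 5 / ε ≤ k)
    (hn : 64800 / ε ^ 2 ≤ n)
    (h : ε ≤ 1 / k + 72 * (ε / 180 / 2 + (2 * C + k) / (k * (ε / 180) * n))) :
    ε ^ 2 / 64800 * (n * k) ≤ C := by
  have hk0 : 0 < k := lt_of_lt_of_le (by positivity) hk
  have hn0 : 0 < n := lt_of_lt_of_le (by positivity) hn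
  have hk' : 1 / k ≤ ε / 5 := by
    rw [div_le_div_iff₀ hk0 (by norm_num)]
    rw [div_le_iff₀ hε] at hk
    linarith
  have hn' : 12960 / (ε * n) ≤ ε / 5 := by
    rw [div_le_div_iff₀ (by positivity) (by norm_num)]
    rw [div_le_iff₀ (by positivity)] at hn
    linarith
  have hsplit : 72 * (ε / 180 / 2 + (2 * C + k) / (k * (ε / 180) * n)) =
      ε / 5 + 25920 * C / (ε * (n * k)) + 12960 / (ε * n) := by
    field_simp
    ring
  have hC : 2 * ε / 5 ≤ 25920 * C / (ε * (n * k)) := by linarith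
  rw [le_div_iff₀ (by positivity)] at hC
  linarith

theorem le_cc_taskAllocation {δ : ℝ} (hδ0 : 0 ≤ δ) (hδ1 : δ < 1) {n k : ℕ}
    (hn : 64800 / (1 - δ) ^ 2 ≤ n) (hk : 5 / (1 - δ) ≤ k) :
    ENNReal.ofReal ((1 - δ) ^ 2 / 64800 * ((n : ℝ) * k)) ≤ ((taskAllocation n k).cc δ : ℝ≥0∞) := by
  have hε : 0 < 1 - δ := sub_pos.2 hδ1
  have : NeZero n := ⟨fun h => by
    have : 0 < 64800 / (1 - δ) ^ 2 := by positivity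
    exact this.not_ge (by simpa [h] using hn)⟩
  have : NeZero k := ⟨fun h => by
    have : 0 < 5 / (1 - δ) := by positivity
    exact this.not_ge (by simpa [h] using hk)⟩
  set m := ⌈(1 - δ) ^ 2 / 64800 * ((n : ℝ) * k)⌉₊
  have hcc : (m : ℕ∞) ≤ (taskAllocation n k).cc δ := by
    refine le_iInf₂ fun P hP => le_of_not_gt fun hlt => ?_
    obtain ⟨C, hC⟩ := ENat.ne_top_iff_exists.1 hlt.ne_top
    rw [← hC, Nat.cast_lt] at hlt
    exact (Nat.lt_ceil.1 hlt).not_ge (mul_le_of_le_one_div_add hε hk hn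
      (hP.one_sub_le hδ0 hC.symm.le (by positivity)))
  calc ENNReal.ofReal ((1 - δ) ^ 2 / 64800 * (n * k)) ≤ ENNReal.ofReal m :=
        ENNReal.ofReal_le_ofReal (Nat.le_ceil _)
    _ = ((m : ℕ∞) : ℝ≥0∞) := by simp
    _ ≤ _ := by exact_mod_cast hcc

/-! ### Flagging the first use of each channel -/

section Flag

variable {k : ℕ} {In Out : Type}

/-- Delete the last bit on each channel; this is `unflag` for transcripts in reverse order, which
are easier to recurse on. -/
def dropLastOnChannels : Transcript k → Transcript k
  | [] => []
  | e :: l => if channel e.1 l = [] then dropLastOnChannels l else e :: dropLastOnChannels l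

/-- Insert the bit `false` just after the last use of each channel; this is `withFlags` for
transcripts in reverse order. -/
def addLastOnChannels : Transcript k → Transcript k
  | [] => []
  | e :: l => e :: if channel e.1 l = [] then (e.1, false) :: addLastOnChannels l
      else addLastOnChannels l

/-- Delete the first bit on each channel. -/
def unflag (σ : Transcript k) : Transcript k := (dropLastOnChannels σ.reverse).reverse

/-- Insert the bit `false` on each channel just before its first use. -/
def withFlags (τ : Transcript k) : Transcript k := (addLastOnChannels τ.reverse).reverse

theorem channel_reverse (i : Fin k) (σ : Transcript k) :
    channel i σ.reverse = (channel i σ).reverse := by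
  simp [channel]

theorem unflag_concat (σ : Transcript k) (e : Fin k × Bool) :
    unflag (σ ++ [e]) = if channel e.1 σ = [] then unflag σ else unflag σ ++ [e] := by
  simp only [unflag, List.reverse_append, List.reverse_singleton, List.singleton_append,
    dropLastOnChannels, channel_reverse, List.reverse_eq_nil_iff]
  split_ifs <;> simp

theorem withFlags_concat (τ : Transcript k) (e : Fin k × Bool) :
    withFlags (τ ++ [e]) =
      if channel e.1 τ = [] then withFlags τ ++ [(e.1, false)] ++ [e] else withFlags τ ++ [e] := by
  simp only [withFlags, List.reverse_append, List.reverse_singleton, List.singleton_append,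
    addLastOnChannels, channel_reverse, List.reverse_eq_nil_iff]
  split_ifs <;> simp

theorem getLast?_withFlags (τ : Transcript k) : (withFlags τ).getLast? = τ.getLast? := by
  induction τ using List.reverseRecOn with
  | nil => rfl
  | append_singleton τ e => rw [withFlags_concat]; split_ifs <;> simp

theorem channel_withFlags (i : Fin k) (τ : Transcript k) :
    channel i (withFlags τ) = if channel i τ = [] then [] else false :: channel i τ := by
  induction τ using List.reverseRecOn with
  | nil => rfl
  | append_singleton τ e ih =>
    rw [withFlags_concat]
    by_cases hi : e.1 = i
    · subst hi
      by_cases h : channel e.1 τ = [] <;>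
        simp [-List.append_assoc, channel_concat, h, ih]
    · split_ifs <;> simp_all [-List.append_assoc, channel_concat]

theorem channel_withFlags_eq_nil_iff {i : Fin k} {τ : Transcript k} :
    channel i (withFlags τ) = [] ↔ channel i τ = [] := by
  rw [channel_withFlags]; simp

theorem unflag_withFlags (τ : Transcript k) : unflag (withFlags τ) = τ := by
  induction τ using List.reverseRecOn with
  | nil => rfl
  | append_singleton τ e ih =>
    rw [withFlags_concat]
    split_ifs with h <;>
      simp [-List.append_assoc, unflag_concat, channel_concat, channel_withFlags_eq_nil_iff, h, ih]

theorem length_withFlags_le (τ : Transcript k) : (withFlags τ).length ≤ τ.length + k := by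
  rw [← sum_length_channel, ← sum_length_channel]
  calc ∑ i, (channel i (withFlags τ)).length ≤ ∑ i, ((channel i τ).length + 1) := by
        refine Finset.sum_le_sum fun i _ => ?_
        rw [channel_withFlags]
        split_ifs <;> simp
    _ = _ := by simp [Finset.sum_add_distrib]

namespace Protocol

/-- The protocol in which the coordinator sends the extra bit `false` on each channel before it is
used for the first time. -/
@[reducible] def flag (P : Protocol k In Out) : Protocol k In Out where
  CoordCoins := P.CoordCoins
  PlayerCoins := P.PlayerCoins
  coordLaw := P.coordLaw
  playerLaw := P.playerLaw
  playerTurn i h := decide (2 ≤ h.length) && P.playerTurn i h.tail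
  coord r σ := Sum.map id (fun e => if channel e.1 σ = [] then (e.1, false) else e)
    (P.coord r (unflag σ))
  player i r x h := P.player i r x h.tail
  measurableSet_coord σ a := by
    rcases a with y | e
    · convert P.measurableSet_coord (unflag σ) (Sum.inl y) using 3 with r
      rcases P.coord r (unflag σ) with y' | e' <;> simp
    · have hunion : {r | Sum.map id (fun e => if channel e.1 σ = [] then (e.1, false) else e)
          (P.coord r (unflag σ)) = (Sum.inr e : Out ⊕ (Fin k × Bool))} =
          ⋃ e' ∈ {e' : Fin k × Bool | (if channel e'.1 σ = [] then (e'.1, false) else e') = e},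
            {r | P.coord r (unflag σ) = Sum.inr e'} := by
        ext r
        rcases h : P.coord r (unflag σ) with y' | e' <;> simp [h]
      rw [hunion]
      exact MeasurableSet.biUnion (Set.to_countable _) fun e' _ => P.measurableSet_coord _ _
  measurableSet_player i x h b := P.measurableSet_player i x h.tail b

variable (P : Protocol k In Out) {X : Fin k → In} {ρ : P.Coins} {τ σ : Transcript k} {y : Out}
  {i : Fin k} {b : Bool}

theorem channel_ne_nil_of_isWaiting (h : P.IsWaiting τ) (hn : P.next X ρ τ = Sum.inr (i, b)) :
    channel i τ ≠ [] := by
  obtain ⟨i', b', hlast, hturn⟩ := h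
  obtain ⟨rfl, -⟩ : i' = i ∧ _ := by
    simpa [P.next_of_playerTurn hlast hturn] using hn
  exact channel_ne_nil_of_getLast? hlast

theorem isWaiting_flag_withFlags_iff : P.flag.IsWaiting (withFlags τ) ↔ P.IsWaiting τ := by
  unfold IsWaiting
  rw [getLast?_withFlags]
  refine exists_congr fun i => exists_congr fun b => and_congr_right fun hlast => ?_
  have hne := channel_ne_nil_of_getLast? hlast
  have hlen : 1 ≤ (channel i τ).length := List.length_pos_iff.2 hne
  simp [channel_withFlags, hne, hlen]

theorem not_isWaiting_flag_concat (hi : channel i σ = []) :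
    ¬ P.flag.IsWaiting (σ ++ [(i, b)]) := by
  rintro ⟨i', b', hlast, hturn⟩
  obtain ⟨rfl, rfl⟩ : i = i' ∧ b = b' := by simpa using hlast
  simp [channel_concat, hi] at hturn

theorem flag_next_withFlags (X : Fin k → In) (ρ : P.Coins) (τ : Transcript k) :
    P.flag.next X ρ (withFlags τ) =
      Sum.map id (fun e => if channel e.1 τ = [] then (e.1, false) else e) (P.next X ρ τ) := by
  by_cases h : P.IsWaiting τ
  · obtain ⟨i, b, hlast, hturn⟩ := id h
    obtain ⟨i', b', hlast', hturn'⟩ := P.isWaiting_flag_withFlags_iff.2 h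
    obtain ⟨rfl, rfl⟩ : i = i' ∧ b = b' := by simpa [getLast?_withFlags, hlast] using hlast'
    rw [P.next_of_playerTurn hlast hturn, P.flag.next_of_playerTurn hlast' hturn']
    have hne := channel_ne_nil_of_getLast? hlast
    simp [channel_withFlags, hne]
  · rw [P.next_of_not_isWaiting h,
      P.flag.next_of_not_isWaiting (mt P.isWaiting_flag_withFlags_iff.1 h)]
    simp only [unflag_withFlags, channel_withFlags_eq_nil_iff]

theorem flag_next_withFlags_concat (hi : channel i τ = [])
    (hn : P.next X ρ τ = Sum.inr (i, b)) :
    P.flag.next X ρ (withFlags τ ++ [(i, false)]) = Sum.inr (i, b) := by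
  have hi' := channel_withFlags_eq_nil_iff.2 hi
  have hw : ¬ P.IsWaiting τ := fun h => P.channel_ne_nil_of_isWaiting h hn hi
  rw [P.next_of_not_isWaiting hw] at hn
  rw [P.flag.next_of_not_isWaiting (P.not_isWaiting_flag_concat hi')]
  simp [unflag_concat, hi', unflag_withFlags, hn, channel_concat]

theorem exists_flag_exec (X : Fin k → In) (ρ : P.Coins) (m : ℕ) :
    ∃ m', P.flag.exec X ρ m = withFlags (P.exec X ρ m') ∨
      ∃ i b, channel i (P.exec X ρ m') = [] ∧ P.next X ρ (P.exec X ρ m') = Sum.inr (i, b) ∧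
        P.flag.exec X ρ m = withFlags (P.exec X ρ m') ++ [(i, false)] := by
  induction m with
  | zero => exact ⟨0, Or.inl rfl⟩
  | succ m ih =>
    obtain ⟨m', h | ⟨i, b, hi, hn, h⟩⟩ := ih
    · have hnext := P.flag_next_withFlags X ρ (P.exec X ρ m')
      rw [← h] at hnext
      rcases hn : P.next X ρ (P.exec X ρ m') with y | ⟨i, b⟩ <;>
        simp only [hn, Sum.map_inl, Sum.map_inr] at hnext
      · exact ⟨m', Or.inl (by rw [P.flag.exec_succ_of_inl hnext, h])⟩
      · by_cases hi : channel i (P.exec X ρ m') = []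
        · rw [if_pos hi] at hnext
          exact ⟨m', Or.inr ⟨i, b, hi, hn, by rw [P.flag.exec_succ_of_inr hnext, h]⟩⟩
        · rw [if_neg hi] at hnext
          refine ⟨m' + 1, Or.inl ?_⟩
          rw [P.flag.exec_succ_of_inr hnext, P.exec_succ_of_inr hn, withFlags_concat, if_neg hi, h]
    · refine ⟨m' + 1, Or.inl ?_⟩
      have hnext := P.flag_next_withFlags_concat hi hn
      rw [← h] at hnext
      rw [P.flag.exec_succ_of_inr hnext, P.exec_succ_of_inr hn, withFlags_concat, if_pos hi, h]

theorem exists_ends_of_flag_ends (h : P.flag.Ends X ρ σ y) :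
    ∃ τ, P.Ends X ρ τ y ∧ withFlags τ = σ := by
  obtain ⟨⟨m, rfl⟩, hend⟩ := h
  obtain ⟨m', h | ⟨i, b, hi, hn, h⟩⟩ := P.exists_flag_exec X ρ m
  · rw [h, P.flag_next_withFlags] at hend
    refine ⟨_, ⟨⟨m', rfl⟩, ?_⟩, h.symm⟩
    rcases hn : P.next X ρ (P.exec X ρ m') with y' | e
    · simpa [hn] using hend
    · simp [hn] at hend
  · rw [h, P.flag_next_withFlags_concat hi hn] at hend
    cases hend

theorem flag_cost_le : P.flag.cost ≤ P.cost + k := by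
  refine iSup_le fun X => iSup_le fun ρ => iSup_le fun m => ?_
  obtain ⟨m', hm'⟩ : ∃ m', (P.flag.exec X ρ m).length ≤ (P.exec X ρ m').length + k := by
    obtain ⟨m', h | ⟨i, b, hi, hn, h⟩⟩ := P.exists_flag_exec X ρ m
    · exact ⟨m', h ▸ length_withFlags_le _⟩
    · have hsucc : P.flag.exec X ρ m ++ [(i, b)] = withFlags (P.exec X ρ (m' + 1)) := by
        rw [P.exec_succ_of_inr hn, withFlags_concat, if_pos hi, h]
      refine ⟨m' + 1, le_trans ?_ (length_withFlags_le _)⟩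
      simp [← hsucc]
  calc ((P.flag.exec X ρ m).length : ℕ∞) ≤ ((P.exec X ρ m').length + k : ℕ) := by
        exact_mod_cast hm'
    _ ≤ _ := by
        push_cast
        gcongr
        exact P.length_exec_le_cost X ρ m'

theorem EndsRecognizably.flag {P : Protocol k In Out} (hP : P.EndsRecognizably) :
    P.flag.EndsRecognizably := by
  intro i X X' ρ ρ' σ σ' y y' h h' hne hp
  obtain ⟨τ, hτ, rfl⟩ := P.exists_ends_of_flag_ends h
  obtain ⟨τ', hτ', rfl⟩ := P.exists_ends_of_flag_ends h'
  rw [channel_withFlags] at hne hp ⊢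
  rw [channel_withFlags] at hp ⊢
  split_ifs at hne hp ⊢ with h₁ h₂
  · simp at hne
  · simp at hne
  · simp at hp
  · rw [List.cons_prefix_cons] at hp
    rw [hP i X X' ρ ρ' τ τ' y y' hτ hτ' h₁ hp.2]

theorem channel_of_flag_ends (h : P.flag.Ends X ρ σ y) (i : Fin k) :
    channel i σ = [] ∨ ∃ u, channel i σ = false :: u := by
  obtain ⟨τ, -, rfl⟩ := P.exists_ends_of_flag_ends h
  rw [channel_withFlags]
  split_ifs
  · exact Or.inl rfl
  · exact Or.inr ⟨_, rfl⟩

end Protocol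

end Flag

/-! ### Querying every player after a protocol -/

section Query

variable {k : ℕ} {In In' Out Out' Msg : Type}

/-- What the coordinator does after it has obtained an output in `Out` from another protocol: it
sends a message, encoded by a prefix-free code, to every player, receives a reply of fixed length
from each, and answers. -/
structure QueryPhase (k : ℕ) (In Out Out' Msg : Type) where
  len : ℕ
  code : Msg → List Bool
  msg : Out → Fin k → Msg
  reply : Fin k → In → Msg → List Bool
  ans : Out → (Fin k → List Bool) → Out'
  code_ne_nil : ∀ m, code m ≠ []
  eq_of_code_isPrefix : ∀ m m', code m <+: code m' → m = m'
  length_reply : ∀ i x m, (reply i x m).length = len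

namespace QueryPhase

variable (S : QueryPhase k In' Out Out' Msg)

/-- A player who has not been contacted before is sent the bit `true` first. -/
def lead (τ : Transcript k) (i : Fin k) : List Bool := if channel i τ = [] then [true] else []

/-- The bits sent to player `i`. -/
def request (τ : Transcript k) (y : Out) (i : Fin k) : List Bool :=
  lead τ i ++ S.code (S.msg y i)

/-- The schedule of the bits that are exchanged with the players in `L`; the bits that the
coordinator sends are given. -/
def script (τ : Transcript k) (y : Out) (L : List (Fin k)) : List (Fin k × Option Bool) :=
  L.flatMap fun i => (S.request τ y i).map (fun b => (i, some b)) ++ List.replicate S.len (i, none)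

/-- What the coordinator does after `tail` has been exchanged. -/
def act (τ : Transcript k) (y : Out) (tail : Transcript k) : Out' ⊕ (Fin k × Bool) :=
  match (S.script τ y (List.finRange k)).drop tail.length with
  | [] => Sum.inl (S.ans y fun i => (channel i tail).drop ((channel i tail).length - S.len))
  | (i, b) :: _ => Sum.inr (i, b.getD false)

/-- The bits that are exchanged with player `i`. -/
def word (X : Fin k → In') (τ : Transcript k) (y : Out) (i : Fin k) : List Bool :=
  S.request τ y i ++ S.reply i (X i) (S.msg y i)

/-- The bits that are exchanged with the players in `L`. -/
def exchange (X : Fin k → In') (τ : Transcript k) (y : Out) (L : List (Fin k)) : Transcript k :=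
  L.flatMap fun i => (S.word X τ y i).map fun b => (i, b)

theorem length_exchange (X : Fin k → In') (τ : Transcript k) (y : Out) (L : List (Fin k)) :
    (S.exchange X τ y L).length = (S.script τ y L).length := by
  induction L with
  | nil => rfl
  | cons i L ih =>
    simp only [exchange, script, List.flatMap_cons, List.length_append] at ih ⊢
    rw [ih]
    simp [word, S.length_reply]

theorem channel_exchange (X : Fin k → In') (τ : Transcript k) (y : Out) {L : List (Fin k)}
    (hL : L.Nodup) (i : Fin k) :
    channel i (S.exchange X τ y L) = if i ∈ L then S.word X τ y i else [] := by
  induction L with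
  | nil => rfl
  | cons j L ih =>
    rw [List.nodup_cons] at hL
    have : S.exchange X τ y (j :: L) =
        (S.word X τ y j).map (fun b => (j, b)) ++ S.exchange X τ y L := rfl
    rw [this, channel_append, channel_map_mk, ih hL.2]
    by_cases hj : j = i
    · subst hj; simp [hL.1]
    · simp [hj, Ne.symm hj]

theorem channel_exchange_finRange (X : Fin k → In') (τ : Transcript k) (y : Out) (i : Fin k) :
    channel i (S.exchange X τ y (List.finRange k)) = S.word X τ y i := by
  rw [S.channel_exchange X τ y (List.nodup_finRange k), if_pos (List.mem_finRange i)]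

theorem length_exchange_finRange_le (X : Fin k → In') (τ : Transcript k) (y : Out) :
    (S.exchange X τ y (List.finRange k)).length ≤
      ∑ i, (S.code (S.msg y i)).length + k * (S.len + 1) := by
  rw [← sum_length_channel]
  calc _ ≤ ∑ i, ((S.code (S.msg y i)).length + (S.len + 1)) := by
        refine Finset.sum_le_sum fun i _ => ?_
        have hlead : (lead τ i).length ≤ 1 := by
          unfold lead; split_ifs <;> simp
        rw [S.channel_exchange_finRange, word, request, List.length_append, List.length_append,
          S.length_reply]
        omega
    _ = _ := by simp [Finset.sum_add_distrib]

end QueryPhase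

namespace Protocol

theorem measurableSet_of_coord (P : Protocol k In Out) [Countable Out] (τ : Transcript k)
    {Φ : Out ⊕ (Fin k × Bool) → P.CoordCoins → Prop} (h : ∀ o, MeasurableSet {r | Φ o r}) :
    MeasurableSet {r | Φ (P.coord r τ) r} := by
  have : {r | Φ (P.coord r τ) r} = ⋃ o, {r | P.coord r τ = o} ∩ {r | Φ o r} := by
    ext r; simp
  rw [this]
  exact MeasurableSet.iUnion fun o => (P.measurableSet_coord τ o).inter (h o)

variable (P : Protocol k In Out) (S : QueryPhase k In' Out Out' Msg)

open Classical in
/-- The output of the coordinator after the transcript `τ`, if it gives one. -/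
noncomputable def finish (r : P.CoordCoins) (τ : Transcript k) : Option Out :=
  if P.IsWaiting τ then none else (P.coord r τ).getLeft?

theorem finish_eq_some_iff {X : Fin k → In} {ρ : P.Coins} {τ : Transcript k} {y : Out} :
    P.finish ρ.1 τ = some y ↔ P.next X ρ τ = Sum.inl y := by
  rw [P.next_eq_inl_iff, finish]
  split_ifs with h <;> simp [h]

theorem finish_eq_none {X : Fin k → In} {ρ : P.Coins} {τ : Transcript k} {e : Fin k × Bool}
    (h : P.next X ρ τ = Sum.inr e) : P.finish ρ.1 τ = none := by
  rcases h' : P.finish ρ.1 τ with _ | y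
  · rfl
  · rw [P.finish_eq_some_iff (X := X), h] at h'
    simp at h'

/-- The coordinator first runs `P` and then the queries; `τ` is the part of the transcript that is
known to belong to `P`, and the second transcript is the rest. -/
noncomputable def queryCoord (r : P.CoordCoins) :
    Transcript k → Transcript k → Out' ⊕ (Fin k × Bool)
  | τ, [] => (P.coord r τ).elim (fun y => S.act τ y []) Sum.inr
  | τ, e :: σ => (P.finish r τ).elim (queryCoord r (τ ++ [e]) σ) (fun y => S.act τ y (e :: σ))

theorem measurableSet_queryCoord [Countable Out] (σ τ : Transcript k)
    (a : Out' ⊕ (Fin k × Bool)) : MeasurableSet {r | P.queryCoord S r τ σ = a} := by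
  induction σ generalizing τ with
  | nil =>
    exact P.measurableSet_of_coord τ
      (Φ := fun o _ => o.elim (fun y => S.act τ y []) Sum.inr = a) fun o => .const _
  | cons e σ ih =>
    simp only [queryCoord, finish]
    by_cases h : P.IsWaiting τ
    · simp only [h, if_true, Option.elim_none]
      exact ih _
    · simp only [h, if_false]
      refine P.measurableSet_of_coord τ (Φ := fun o r => o.getLeft?.elim
        (P.queryCoord S r (τ ++ [e]) σ) (fun y => S.act τ y (e :: σ)) = a) fun o => ?_
      rcases o with y | _
      · exact .const (S.act τ y (e :: σ) = a)
      · exact ih _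

/-- `u` is what the channel of player `i` can hold just before the message of the query: the bit
`true` if `P` has not used the channel, and otherwise a complete conversation of `P`. -/
def IsStart (i : Fin k) (u : List Bool) : Prop :=
  u = [true] ∨ u ≠ [] ∧ ∃ X ρ τ y, P.Ends X ρ τ y ∧ channel i τ = u

/-- The bits `h` on the channel of player `i` mean that it has received the message `q.1` of the
query, has sent the part `q.2` of its reply, and has not finished. -/
def IsRequest (i : Fin k) (h : List Bool) (q : Msg × List Bool) : Prop :=
  (∃ u, P.IsStart i u ∧ h = u ++ S.code q.1 ++ q.2) ∧ q.2.length < S.len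

open Classical in
/-- Run `P`, with inputs translated by `g`, and then the queries. -/
@[reducible] noncomputable def thenQuery [Countable Out] (g : In' → In) : Protocol k In' Out' where
  CoordCoins := P.CoordCoins
  PlayerCoins := P.PlayerCoins
  coordLaw := P.coordLaw
  playerLaw := P.playerLaw
  playerTurn i h :=
    if ∃ u, P.IsStart i u ∧ u <+: h then decide (∃ q, P.IsRequest S i h q)
    else P.playerTurn i h
  coord r σ := P.queryCoord S r [] σ
  player i r x h :=
    if hq : ∃ q, P.IsRequest S i h q then
      (S.reply i x hq.choose.1).getD hq.choose.2.length false
    else P.player i r (g x) h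
  measurableSet_coord σ a := P.measurableSet_queryCoord S σ [] a
  measurableSet_player i x h b := by
    by_cases hq : ∃ q, P.IsRequest S i h q
    · simp only [hq, dif_pos]; exact .const _
    · simp only [hq, dif_neg, not_false_eq_true]; exact P.measurableSet_player i (g x) h b

/-- The protocol ends recognizably, and every conversation begins with the bit `false`. -/
structure IsFlagged : Prop where
  endsRecognizably : P.EndsRecognizably
  channel_eq : ∀ i X ρ τ y, P.Ends X ρ τ y → channel i τ = [] ∨ ∃ u, channel i τ = false :: u

variable {P} {S}

theorem IsFlagged.start_eq_of_isPrefix (hP : P.IsFlagged) {i : Fin k} {u u' : List Bool}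
    (hu : P.IsStart i u) (hu' : P.IsStart i u') (hp : u <+: u') : u = u' := by
  rcases hu with rfl | ⟨hne, X, ρ, τ, y, he, rfl⟩ <;>
    rcases hu' with rfl | ⟨hne', X', ρ', τ', y', he', rfl⟩
  · rfl
  · obtain ⟨w, hw⟩ := (hP.channel_eq i _ _ _ _ he').resolve_left hne'
    simp [hw] at hp
  · obtain ⟨w, hw⟩ := (hP.channel_eq i _ _ _ _ he).resolve_left hne
    simp [hw] at hp
  · exact hP.endsRecognizably i X X' ρ ρ' τ τ' y y' he he' hne hp

theorem IsFlagged.start_unique (hP : P.IsFlagged) {i : Fin k} {u u' h : List Bool}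
    (hu : P.IsStart i u) (hu' : P.IsStart i u') (hp : u <+: h) (hp' : u' <+: h) : u = u' := by
  rcases List.prefix_or_prefix_of_prefix hp hp' with h | h
  · exact hP.start_eq_of_isPrefix hu hu' h
  · exact (hP.start_eq_of_isPrefix hu' hu h).symm

theorem IsFlagged.request_unique (hP : P.IsFlagged) {i : Fin k} {u u' s s' : List Bool}
    {m m' : Msg} (hu : P.IsStart i u) (hu' : P.IsStart i u')
    (h : u ++ S.code m ++ s <+: u' ++ S.code m' ++ s') : u = u' ∧ m = m' ∧ s <+: s' := by
  simp only [List.append_assoc] at h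
  obtain rfl := hP.start_unique hu hu' ((List.prefix_append _ _).trans h) (List.prefix_append _ _)
  rw [List.prefix_append_right_inj] at h
  obtain rfl : m = m' := by
    rcases List.prefix_or_prefix_of_prefix ((List.prefix_append _ _).trans h)
      (List.prefix_append (S.code m') s') with hm | hm
    · exact S.eq_of_code_isPrefix _ _ hm
    · exact (S.eq_of_code_isPrefix _ _ hm).symm
  exact ⟨rfl, rfl, (List.prefix_append_right_inj _).1 h⟩

theorem IsFlagged.no_start_of_append (hP : P.IsFlagged) {X : Fin k → In} {ρ : P.Coins}
    {τ τ' : Transcript k} {y : Out} (he : P.Ends X ρ τ y) {i : Fin k} {b : Bool}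
    (hp : channel i τ' ++ [b] <+: channel i τ) :
    ¬ ∃ u, P.IsStart i u ∧ u <+: channel i τ' := by
  rintro ⟨u, hu, hu'⟩
  have hne : channel i τ ≠ [] := fun h => by simp [h] at hp
  obtain rfl := hP.start_unique hu (Or.inr ⟨hne, X, ρ, τ, y, he, rfl⟩)
    ((hu'.trans (List.prefix_append _ _)).trans hp) List.prefix_rfl
  simpa using hp.length_le.trans hu'.length_le

theorem IsFlagged.not_isRequest_of_isPrefix (hP : P.IsFlagged) {X : Fin k → In} {ρ : P.Coins}
    {τ : Transcript k} {y : Out} (he : P.Ends X ρ τ y) {i : Fin k} {h : List Bool}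
    (hne : channel i τ ≠ []) (hp : h <+: channel i τ) : ¬ ∃ q, P.IsRequest S i h q := by
  rintro ⟨⟨m, s⟩, ⟨u, hu, rfl⟩, -⟩
  rw [List.append_assoc] at hp
  obtain rfl := hP.start_unique hu (Or.inr ⟨hne, X, ρ, τ, y, he, rfl⟩)
    ((List.prefix_append _ _).trans hp) List.prefix_rfl
  have hcode := List.length_pos_iff.2 (S.code_ne_nil m)
  have hle := hp.length_le
  simp only [List.length_append] at hle
  omega

theorem exists_exec_of_isPrefix {P : Protocol k In Out} {X : Fin k → In} {ρ : P.Coins}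
    {σ : Transcript k} {m : ℕ} (h : σ <+: P.exec X ρ m) : ∃ m' ≤ m, P.exec X ρ m' = σ := by
  induction m with
  | zero => exact ⟨0, le_rfl, (List.prefix_nil.1 h).symm⟩
  | succ m ih =>
    rcases P.exec_succ_cases X ρ m with ⟨y, -, hm⟩ | ⟨e, -, hm⟩
    · rw [hm] at h
      obtain ⟨m', hm', h⟩ := ih h
      exact ⟨m', by omega, h⟩
    · rw [hm] at h
      rcases List.prefix_concat_iff.1 h with h | h
      · exact ⟨m + 1, le_rfl, by rw [hm, h]⟩
      · obtain ⟨m', hm', h⟩ := ih h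
        exact ⟨m', by omega, h⟩

theorem finish_of_isPrefix {X : Fin k → In} {ρ : P.Coins} {σ : Transcript k} {m : ℕ}
    (h : σ <+: P.exec X ρ m) (hne : σ ≠ P.exec X ρ m) : P.finish ρ.1 σ = none := by
  obtain ⟨m', hm', rfl⟩ := exists_exec_of_isPrefix h
  rcases hn : P.next X ρ (P.exec X ρ m') with y | e
  · exact absurd (P.exec_eq_of_inl hn hm').symm hne
  · exact P.finish_eq_none hn

theorem queryCoord_append (r : P.CoordCoins) (σ tail : Transcript k) (τ : Transcript k)
    (h : ∀ σ', σ' <+: σ → σ' ≠ σ → P.finish r (τ ++ σ') = none) :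
    P.queryCoord S r τ (σ ++ tail) = P.queryCoord S r (τ ++ σ) tail := by
  induction σ generalizing τ with
  | nil => simp
  | cons e σ ih =>
    have h₀ := h [] List.nil_prefix (by simp)
    rw [List.append_nil] at h₀
    rw [List.cons_append, queryCoord, h₀, Option.elim_none, ih]
    · simp
    · intro σ' hσ' hne
      have := h (e :: σ') (by simpa using hσ') (by simpa using hne)
      simpa using this

theorem queryCoord_exec (X : Fin k → In) (ρ : P.Coins) (m : ℕ) (tail : Transcript k) :
    P.queryCoord S ρ.1 [] (P.exec X ρ m ++ tail) = P.queryCoord S ρ.1 (P.exec X ρ m) tail := by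
  rw [queryCoord_append]
  · simp
  · intro σ' hp hne
    rw [List.nil_append]
    exact finish_of_isPrefix hp hne

theorem queryCoord_of_ends {X : Fin k → In} {ρ : P.Coins} {τ : Transcript k} {y : Out}
    (h : P.Ends X ρ τ y) (tail : Transcript k) :
    P.queryCoord S ρ.1 [] (τ ++ tail) = S.act τ y tail := by
  obtain ⟨⟨m, rfl⟩, hn⟩ := h
  rw [queryCoord_exec]
  rcases tail with _ | ⟨e, σ⟩
  · rw [queryCoord, (P.next_eq_inl_iff.1 hn).2]; rfl
  · rw [queryCoord, P.finish_eq_some_iff.2 hn]; rfl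

variable [Countable Out] {g : In' → In}

theorem IsFlagged.playerTurn_of_lt (hP : P.IsFlagged) {i : Fin k} {u v w : List Bool} {b : Bool}
    {m : Msg} (hu : P.IsStart i u) (hm : S.code m = v ++ b :: w) :
    (P.thenQuery S g).playerTurn i (u ++ v) = false := by
  have hstart : ∃ u', P.IsStart i u' ∧ u' <+: u ++ v := ⟨u, hu, List.prefix_append _ _⟩
  simp only [hstart, if_true, decide_eq_false_iff_not]
  rintro ⟨⟨m', s⟩, ⟨u', hu', h⟩, -⟩
  have hp : u' ++ S.code m' ++ s <+: u ++ S.code m ++ [] := by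
    rw [← h, hm]; simp
  obtain ⟨rfl, rfl, -⟩ := hP.request_unique hu' hu hp
  have := congrArg List.length h
  simp only [hm, List.length_append, List.length_cons] at this
  omega

theorem IsFlagged.playerTurn_of_le (hP : P.IsFlagged) {i : Fin k} {u s : List Bool} {m : Msg}
    (hu : P.IsStart i u) (hs : S.len ≤ s.length) :
    (P.thenQuery S g).playerTurn i (u ++ S.code m ++ s) = false := by
  have hstart : ∃ u', P.IsStart i u' ∧ u' <+: u ++ S.code m ++ s :=
    ⟨u, hu, by rw [List.append_assoc]; exact List.prefix_append _ _⟩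
  simp only [hstart, if_true, decide_eq_false_iff_not]
  rintro ⟨⟨m', s'⟩, ⟨u', hu', h⟩, hlt⟩
  have hp : u ++ S.code m ++ s <+: u' ++ S.code m' ++ s' := by rw [h]
  exact hlt.not_ge (hs.trans (hP.request_unique hu hu' hp).2.2.length_le)

theorem playerTurn_of_request {i : Fin k} {u s : List Bool} {m : Msg} (hu : P.IsStart i u)
    (hs : s.length < S.len) :
    (P.thenQuery S g).playerTurn i (u ++ S.code m ++ s) = true := by
  have hstart : ∃ u', P.IsStart i u' ∧ u' <+: u ++ S.code m ++ s :=
    ⟨u, hu, by rw [List.append_assoc]; exact List.prefix_append _ _⟩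
  have hrequest : ∃ q, P.IsRequest S i (u ++ S.code m ++ s) q := ⟨(m, s), ⟨u, hu, rfl⟩, hs⟩
  simp only [hstart, hrequest, if_true, decide_true]

theorem IsFlagged.player_of_request (hP : P.IsFlagged) {i : Fin k} {u s : List Bool} {m : Msg}
    (hu : P.IsStart i u) (hs : s.length < S.len) (r : P.PlayerCoins i) (x : In') :
    (P.thenQuery S g).player i r x (u ++ S.code m ++ s) = (S.reply i x m).getD s.length false := by
  have hrequest : ∃ q, P.IsRequest S i (u ++ S.code m ++ s) q := ⟨(m, s), ⟨u, hu, rfl⟩, hs⟩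
  simp only [hrequest, dif_pos]
  obtain ⟨⟨u', hu', h⟩, -⟩ := hrequest.choose_spec
  obtain ⟨-, hm, hle⟩ := hP.request_unique hu hu' (by rw [← h])
  have hge := (hP.request_unique hu' hu (by rw [← h])).2.2
  rw [← hm, hle.length_le.antisymm hge.length_le]

theorem IsFlagged.next_thenQuery_exec (hP : P.IsFlagged) {X : Fin k → In'} {ρ : P.Coins}
    {τ : Transcript k} {y : Out} (he : P.Ends (fun i => g (X i)) ρ τ y) {m : ℕ} {e : Fin k × Bool}
    (hn : P.next (fun i => g (X i)) ρ (P.exec (fun i => g (X i)) ρ m) = Sum.inr e) :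
    (P.thenQuery S g).next X ρ (P.exec (fun i => g (X i)) ρ m) = Sum.inr e := by
  have hpσ := he.exec_isPrefix (m + 1)
  have hcoord := queryCoord_exec (S := S) (fun i => g (X i)) ρ m []
  rw [P.exec_succ_of_inr hn] at hpσ
  rw [List.append_nil] at hcoord
  generalize P.exec (fun i => g (X i)) ρ m = σ at hn hpσ hcoord ⊢
  have hnr : ∀ {i b}, σ.getLast? = some (i, b) → ¬ ∃ q, P.IsRequest S i (channel i σ) q := by
    intro i b hlast
    have hp := channel_prefix_channel i ((List.prefix_append σ [e]).trans hpσ)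
    exact hP.not_isRequest_of_isPrefix he
      (fun h => channel_ne_nil_of_getLast? hlast (List.prefix_nil.1 (h ▸ hp))) hp
  by_cases hw : P.IsWaiting σ
  · obtain ⟨i, b, hlast, hturn⟩ := hw
    obtain rfl : _ = e := by simpa [P.next_of_playerTurn hlast hturn] using hn
    have hns : ¬ ∃ u, P.IsStart i u ∧ u <+: channel i σ := by
      refine hP.no_start_of_append he
        (b := P.player i (ρ.2 i) (g (X i)) (channel i σ)) ?_
      simpa only [channel_concat, if_true] using channel_prefix_channel i hpσ
    rw [(P.thenQuery S g).next_of_playerTurn hlast]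
    · simp only [hnr hlast, dif_neg, not_false_eq_true]
    · simpa only [hns, if_false] using hturn
  · have hw' : ¬ (P.thenQuery S g).IsWaiting σ := by
      rintro ⟨i, b, hlast, hturn⟩
      simp only [hnr hlast, decide_false] at hturn
      split_ifs at hturn
      exact hw ⟨i, b, hlast, hturn⟩
    rw [P.next_of_not_isWaiting hw] at hn
    rw [(P.thenQuery S g).next_of_not_isWaiting hw']
    change P.queryCoord S ρ.1 [] σ = _
    rw [hcoord, queryCoord, hn, Sum.elim_inr]

theorem IsFlagged.exists_thenQuery_exec_eq (hP : P.IsFlagged) {X : Fin k → In'} {ρ : P.Coins}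
    {τ : Transcript k} {y : Out} (he : P.Ends (fun i => g (X i)) ρ τ y) (m : ℕ) :
    ∃ m', (P.thenQuery S g).exec X ρ m' = P.exec (fun i => g (X i)) ρ m := by
  induction m with
  | zero => exact ⟨0, rfl⟩
  | succ m ih =>
    obtain ⟨m', ih⟩ := ih
    rcases hn : P.next (fun i => g (X i)) ρ (P.exec (fun i => g (X i)) ρ m) with y' | e
    · exact ⟨m', by rw [ih, P.exec_succ_of_inl hn]⟩
    · refine ⟨m' + 1, ?_⟩
      rw [(P.thenQuery S g).exec_succ_of_inr (ih ▸ hP.next_thenQuery_exec he hn), ih,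
        P.exec_succ_of_inr hn]

end Protocol

end Query

section Exchange

variable {k : ℕ} {In In' Out Out' Msg : Type}

namespace Protocol

theorem exists_exec_append (P : Protocol k In Out) {X : Fin k → In} {ρ : P.Coins}
    {σ : Transcript k} {i : Fin k} (hσ : ∃ m, P.exec X ρ m = σ) (u : List Bool)
    (hnext : ∀ w b v, u = w ++ b :: v →
      P.next X ρ (σ ++ w.map fun b => (i, b)) = Sum.inr (i, b)) :
    ∃ m, P.exec X ρ m = σ ++ u.map fun b => (i, b) := by
  suffices h : ∀ w v, u = w ++ v → ∃ m, P.exec X ρ m = σ ++ w.map fun b => (i, b) from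
    h u [] (List.append_nil u).symm
  intro w
  induction w using List.reverseRecOn with
  | nil => simpa using hσ
  | append_singleton w b ih =>
    intro v hv
    rw [List.append_assoc, List.singleton_append] at hv
    obtain ⟨m, hm⟩ := ih _ hv
    exact ⟨m + 1, by rw [P.exec_succ_of_inr (hm ▸ hnext w b v hv), hm]; simp⟩

variable {P : Protocol k In Out} {S : QueryPhase k In' Out Out' Msg} {ρ : P.Coins}
  {τ : Transcript k} {y : Out}

theorem Ends.isStart {X : Fin k → In} (he : P.Ends X ρ τ y) (i : Fin k) :
    P.IsStart i (channel i τ ++ QueryPhase.lead τ i) := by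
  by_cases h : channel i τ = []
  · exact Or.inl (by simp [QueryPhase.lead, h])
  · refine Or.inr ?_
    simp only [QueryPhase.lead, h, if_false, List.append_nil]
    exact ⟨h, X, ρ, τ, y, he, rfl⟩

variable [Countable Out] {g : In' → In} {X : Fin k → In'}

theorem IsFlagged.playerTurn_word (hP : P.IsFlagged) (he : P.Ends (fun i => g (X i)) ρ τ y)
    (i : Fin k) :
    (P.thenQuery S g).playerTurn i (channel i τ ++ S.word X τ y i) = false := by
  have h : channel i τ ++ S.word X τ y i = (channel i τ ++ QueryPhase.lead τ i) ++
      S.code (S.msg y i) ++ S.reply i (X i) (S.msg y i) := by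
    simp [QueryPhase.word, QueryPhase.request]
  rw [h]
  exact hP.playerTurn_of_le (he.isStart i) (S.length_reply _ _ _).ge

theorem IsFlagged.playerTurn_request (hP : P.IsFlagged) (he : P.Ends (fun i => g (X i)) ρ τ y)
    (i : Fin k) {w v : List Bool} {b : Bool} (hw : S.request τ y i = w ++ b :: v)
    (hne : channel i τ ++ w ≠ []) :
    (P.thenQuery S g).playerTurn i (channel i τ ++ w) = false := by
  have hstart := he.isStart i
  by_cases h : channel i τ = []
  · simp only [QueryPhase.request, QueryPhase.lead, h, if_true] at hw hstart
    rw [h, List.nil_append] at hne ⊢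
    obtain ⟨c, w, rfl⟩ := List.exists_cons_of_ne_nil hne
    simp only [List.cons_append, List.nil_append, List.cons.injEq] at hw
    obtain ⟨rfl, hw⟩ := hw
    exact hP.playerTurn_of_lt hstart hw
  · simp only [QueryPhase.request, QueryPhase.lead, h, if_false, List.nil_append,
      List.append_nil] at hw hstart
    exact hP.playerTurn_of_lt hstart hw

theorem IsFlagged.not_isWaiting_append (hP : P.IsFlagged)
    (he : P.Ends (fun i => g (X i)) ρ τ y) {tail : Transcript k}
    (htail : ∀ j, channel j tail = S.word X τ y j ∨
      ∃ b v, S.request τ y j = channel j tail ++ b :: v) :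
    ¬ (P.thenQuery S g).IsWaiting (τ ++ tail) := by
  rintro ⟨j, c, hlast, hturn⟩
  have hne := channel_ne_nil_of_getLast? hlast
  rw [channel_append] at hturn hne
  rcases htail j with hj | ⟨b, v, hj⟩
  · rw [hj, hP.playerTurn_word he] at hturn
    exact Bool.false_ne_true hturn
  · rw [hP.playerTurn_request he j hj hne] at hturn
    exact Bool.false_ne_true hturn

theorem IsFlagged.next_request (hP : P.IsFlagged) (he : P.Ends (fun i => g (X i)) ρ τ y)
    {L₁ L₂ : List (Fin k)} {i : Fin k} (hL : List.finRange k = L₁ ++ i :: L₂)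
    {w v : List Bool} {b : Bool} (hw : S.request τ y i = w ++ b :: v) :
    (P.thenQuery S g).next X ρ (τ ++ S.exchange X τ y L₁ ++ w.map fun b => (i, b)) =
      Sum.inr (i, b) := by
  have hnodup : (L₁ ++ i :: L₂).Nodup := hL ▸ List.nodup_finRange k
  have hi : i ∉ L₁ := fun h => List.disjoint_of_nodup_append hnodup h (by simp)
  rw [List.append_assoc, (P.thenQuery S g).next_of_not_isWaiting]
  · have hscript : S.script τ y (L₁ ++ i :: L₂) =
        (S.script τ y L₁ ++ w.map fun b => (i, some b)) ++
          ((i, some b) :: (v.map (fun b => (i, some b)) ++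
            List.replicate S.len (i, none) ++ S.script τ y L₂)) := by
      simp [QueryPhase.script, hw]
    change P.queryCoord S ρ.1 [] (τ ++ _) = _
    rw [queryCoord_of_ends he, QueryPhase.act, hL, hscript,
      List.drop_left' (by simp [S.length_exchange])]
    rfl
  · refine hP.not_isWaiting_append he fun j => ?_
    rw [channel_append, channel_map_mk, S.channel_exchange X τ y hnodup.of_append_left]
    by_cases hj : j ∈ L₁
    · have hij : i ≠ j := fun h => hi (h ▸ hj)
      exact Or.inl (by simp [hj, hij])
    · refine Or.inr ?_
      by_cases hij : i = j
      · subst hij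
        exact ⟨b, v, by simp [hw, hj]⟩
      · obtain ⟨b', v', hb⟩ : ∃ b' v', S.request τ y j = b' :: v' :=
          List.exists_cons_of_ne_nil (by simp [QueryPhase.request, S.code_ne_nil])
        exact ⟨b', v', by simp [hb, hj, hij]⟩

theorem IsFlagged.next_reply (hP : P.IsFlagged) (he : P.Ends (fun i => g (X i)) ρ τ y)
    {σ : Transcript k} {i : Fin k} (hσ : channel i σ = channel i τ) {s v : List Bool} {b : Bool}
    (hs : S.reply i (X i) (S.msg y i) = s ++ b :: v) :
    (P.thenQuery S g).next X ρ (σ ++ (S.request τ y i ++ s).map fun b => (i, b)) =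
      Sum.inr (i, b) := by
  have hchannel : channel i (σ ++ (S.request τ y i ++ s).map fun b => (i, b)) =
      (channel i τ ++ QueryPhase.lead τ i) ++ S.code (S.msg y i) ++ s := by
    simp [channel_append, channel_map_mk, hσ, QueryPhase.request]
  have hlen : s.length < S.len := by
    rw [← S.length_reply i (X i) (S.msg y i), hs]
    simp
  have hlast : ∃ c, (σ ++ (S.request τ y i ++ s).map fun b => (i, b)).getLast? = some (i, c) := by
    have hne : S.request τ y i ++ s ≠ [] := by simp [QueryPhase.request, S.code_ne_nil]
    obtain ⟨w, c, hc⟩ := (List.eq_nil_or_concat _).resolve_left hne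
    exact ⟨c, by simp [hc]⟩
  obtain ⟨c, hlast⟩ := hlast
  have hturn := playerTurn_of_request (S := S) (g := g) (m := S.msg y i) (he.isStart i) hlen
  have hplayer := hP.player_of_request (S := S) (g := g) (m := S.msg y i) (he.isStart i) hlen
  rw [← hchannel] at hturn hplayer
  rw [(P.thenQuery S g).next_of_playerTurn hlast hturn, hplayer, hs]
  simp

theorem IsFlagged.exists_exec_exchange (hP : P.IsFlagged)
    (he : P.Ends (fun i => g (X i)) ρ τ y) (L₁ L₂ : List (Fin k))
    (hL : List.finRange k = L₁ ++ L₂) :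
    ∃ m, (P.thenQuery S g).exec X ρ m = τ ++ S.exchange X τ y L₁ := by
  induction L₁ using List.reverseRecOn generalizing L₂ with
  | nil =>
    obtain ⟨m, rfl⟩ := he.1
    simpa [QueryPhase.exchange] using hP.exists_thenQuery_exec_eq he m
  | append_singleton L i ih =>
    rw [List.append_assoc, List.singleton_append] at hL
    have hnodup : (L ++ i :: L₂).Nodup := hL ▸ List.nodup_finRange k
    have hi : i ∉ L := fun h => List.disjoint_of_nodup_append hnodup h (by simp)
    have hrequest := (P.thenQuery S g).exists_exec_append (ih _ hL) (S.request τ y i)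
      fun w b v hw => hP.next_request he hL hw
    have hreply := (P.thenQuery S g).exists_exec_append hrequest (S.reply i (X i) (S.msg y i))
      fun s b v hs => by
        rw [List.append_assoc, ← List.map_append]
        refine hP.next_reply he ?_ hs
        rw [channel_append, S.channel_exchange X τ y hnodup.of_append_left, if_neg hi,
          List.append_nil]
    simpa [QueryPhase.exchange, QueryPhase.word] using hreply

theorem IsFlagged.ends_exchange (hP : P.IsFlagged) (he : P.Ends (fun i => g (X i)) ρ τ y) :
    (P.thenQuery S g).Ends X ρ (τ ++ S.exchange X τ y (List.finRange k))
      (S.ans y fun i => S.reply i (X i) (S.msg y i)) := by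
  refine ⟨hP.exists_exec_exchange he _ [] (List.append_nil _).symm, ?_⟩
  have hword := S.channel_exchange_finRange X τ y
  rw [(P.thenQuery S g).next_of_not_isWaiting
    (hP.not_isWaiting_append he fun j => Or.inl (hword j))]
  change P.queryCoord S ρ.1 [] (τ ++ _) = _
  rw [queryCoord_of_ends he, QueryPhase.act, S.length_exchange, List.drop_length]
  have hdrop : ∀ j, (S.word X τ y j).drop ((S.word X τ y j).length - S.len) =
      S.reply j (X j) (S.msg y j) := fun j =>
    List.drop_left' (by simp [QueryPhase.word, S.length_reply])
  simp only [hword, hdrop]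

variable {C : ℕ}

theorem IsFlagged.ends_thenQuery (hP : P.IsFlagged) (hC : P.cost ≤ C) {σ : Transcript k}
    {y' : Out'} (h : (P.thenQuery S g).Ends X ρ σ y') :
    ∃ τ y, P.Ends (fun i => g (X i)) ρ τ y ∧
      σ = τ ++ S.exchange X τ y (List.finRange k) := by
  obtain ⟨y, he⟩ := P.exists_ends_exec hC (fun i => g (X i)) ρ
  exact ⟨_, y, he, (h.unique (hP.ends_exchange he)).1⟩

theorem IsFlagged.endsRecognizably_thenQuery (hP : P.IsFlagged) (hC : P.cost ≤ C) :
    (P.thenQuery S g).EndsRecognizably := by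
  intro i X X' ρ ρ' σ σ' y y' h h' _ hp
  obtain ⟨τ, z, he, rfl⟩ := hP.ends_thenQuery hC h
  obtain ⟨τ', z', he', rfl⟩ := hP.ends_thenQuery hC h'
  have hchannel : ∀ (X : Fin k → In') (τ z),
      channel i (τ ++ S.exchange X τ z (List.finRange k)) =
        (channel i τ ++ QueryPhase.lead τ i) ++ S.code (S.msg z i) ++
          S.reply i (X i) (S.msg z i) := fun X τ z => by
    rw [channel_append, S.channel_exchange_finRange X τ z, QueryPhase.word, QueryPhase.request]
    simp
  rw [hchannel, hchannel] at hp ⊢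
  obtain ⟨hstart, hmsg, hreply⟩ := hP.request_unique (he.isStart i) (he'.isStart i) hp
  rw [hstart, hreply.eq_of_length (by rw [S.length_reply, S.length_reply]), hmsg]

theorem IsFlagged.cost_thenQuery_le (hP : P.IsFlagged) (hC : P.cost ≤ C) {B : ℕ}
    (hB : ∀ y, ∑ i, (S.code (S.msg y i)).length ≤ B) :
    (P.thenQuery S g).cost ≤ P.cost + (B + k * (S.len + 1) : ℕ) := by
  refine iSup_le fun X => iSup_le fun ρ => iSup_le fun m => ?_
  obtain ⟨y, he⟩ := P.exists_ends_exec hC (fun i => g (X i)) ρ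
  have hlength := ((hP.ends_exchange (S := S) he).exec_isPrefix m).length_le
  set τ := P.exec (fun i => g (X i)) ρ (C + 1)
  have hexchange := (S.length_exchange_finRange_le X τ y).trans
    (Nat.add_le_add_right (hB y) _)
  rw [List.length_append] at hlength
  calc (((P.thenQuery S g).exec X ρ m).length : ℕ∞) ≤
        (τ.length + (B + k * (S.len + 1)) : ℕ) := by
        exact_mod_cast hlength.trans (Nat.add_le_add_left hexchange _)
    _ ≤ _ := by
        push_cast
        gcongr
        exact P.length_exec_le_cost _ _ _

end Protocol

end Exchange

/-! ### From task allocation to set disjointness -/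

section Reduction

variable {k n : ℕ}

/-- A prefix-free code for lists, built from a code of fixed length for their entries: every entry
is announced by the bit `true`, and the end of the list by the bit `false`. -/
def listCode {α : Type} (f : α → List Bool) : List α → List Bool
  | [] => [false]
  | j :: l => true :: (f j ++ listCode f l)

theorem listCode_ne_nil {α : Type} (f : α → List Bool) (l : List α) : listCode f l ≠ [] := by
  cases l <;> simp [listCode]

theorem length_listCode {α : Type} {f : α → List Bool} {L : ℕ} (hf : ∀ j, (f j).length = L)
    (l : List α) : (listCode f l).length = l.length * (L + 1) + 1 := by
  induction l with
  | nil => simp [listCode]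
  | cons j l ih => simp [listCode, ih, hf]; ring

theorem eq_of_listCode_isPrefix {α : Type} {f : α → List Bool} {L : ℕ}
    (hf : ∀ j, (f j).length = L) (hinj : Function.Injective f) (l l' : List α)
    (h : listCode f l <+: listCode f l') : l = l' := by
  induction l generalizing l' with
  | nil => cases l' <;> simp [listCode] at h ⊢
  | cons j l ih =>
    rcases l' with _ | ⟨j', l'⟩
    · simp [listCode] at h
    · simp only [listCode, List.cons_prefix_cons, true_and] at h
      have hj : f j = f j' := by
        have hlen : (f j).length = (f j').length := by rw [hf, hf]
        exact (List.prefix_of_prefix_length_le ((List.prefix_append (f j) _).trans h)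
          (List.prefix_append (f j') _) hlen.le).eq_of_length hlen
      rw [hj, List.prefix_append_right_inj] at h
      rw [hinj hj, ih l' h]

theorem exists_injective_length_eq_clog (n : ℕ) :
    ∃ f : Fin n → List Bool, Function.Injective f ∧ ∀ j, (f j).length = Nat.clog 2 n := by
  have hcard : Fintype.card (Fin n) ≤ Fintype.card (Fin (Nat.clog 2 n) → Bool) := by
    simpa using Nat.le_pow_clog (by norm_num) n
  obtain ⟨e⟩ := Function.Embedding.nonempty_of_card_le hcard
  exact ⟨fun j => List.ofFn (e j), fun j j' h => e.injective (List.ofFn_injective h),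
    fun j => by simp⟩

open Classical in
/-- Send every player the list of the tasks that are assigned to it, and ask whether none of them
belongs to its input. -/
noncomputable def verifyPhase (f : Fin n → List Bool) {L : ℕ} (hf : ∀ j, (f j).length = L)
    (hinj : Function.Injective f) :
    QueryPhase k (Finset (Fin n)) (Fin n → Fin k) Bool (List (Fin n)) where
  len := 1
  code := listCode f
  msg Y i := (Finset.univ.filter fun j => Y j = i).toList
  reply _ x l := [decide (∀ j ∈ l, j ∉ x)]
  ans _ R := decide (∃ i, R i = [false])
  code_ne_nil := listCode_ne_nil f
  eq_of_code_isPrefix := eq_of_listCode_isPrefix hf hinj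
  length_reply _ _ _ := rfl

theorem sum_length_verifyPhase {f : Fin n → List Bool} {L : ℕ} (hf : ∀ j, (f j).length = L)
    (hinj : Function.Injective f) (Y : Fin n → Fin k) :
    ∑ i, ((verifyPhase (k := k) f hf hinj).code ((verifyPhase f hf hinj).msg Y i)).length =
      n * (L + 1) + k := by
  have hcard : ∑ i : Fin k, (Finset.univ.filter fun j => Y j = i).card = n := by
    rw [← Finset.card_eq_sum_card_fiberwise (fun _ _ => Finset.mem_coe.2 (Finset.mem_univ _))]
    simp
  simp [verifyPhase, length_listCode hf, Finset.sum_add_distrib, ← Finset.sum_mul, hcard]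

theorem verifyPhase_ans (f : Fin n → List Bool) {L : ℕ} (hf : ∀ j, (f j).length = L)
    (hinj : Function.Injective f) (X : Fin k → Finset (Fin n)) (Y : Fin n → Fin k) :
    (verifyPhase f hf hinj).ans Y
      (fun i => (verifyPhase f hf hinj).reply i (X i) ((verifyPhase f hf hinj).msg Y i)) = true ↔
      ∃ j, j ∈ X (Y j) := by
  simp [verifyPhase]

open Classical in
/-- Ask every player for its input, encoded by its characteristic vector. -/
noncomputable def collectPhase (k n : ℕ) :
    QueryPhase k (Finset (Fin n)) Unit Bool Unit where
  len := n
  code _ := [true]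
  msg _ _ := ()
  reply _ x _ := List.ofFn fun j => decide (j ∈ x)
  ans _ R := decide (∃ j : Fin n, ∀ i, (R i)[(j : ℕ)]? = some true)
  code_ne_nil _ := by simp
  eq_of_code_isPrefix _ _ _ := rfl
  length_reply _ _ _ := by simp

/-- The protocol without communication. -/
@[reducible] noncomputable def silent (k : ℕ) (In : Type) : Protocol k In Unit where
  CoordCoins := Unit
  PlayerCoins _ := Unit
  coordLaw := Measure.dirac ()
  playerLaw _ := Measure.dirac ()
  playerTurn _ _ := false
  coord _ _ := Sum.inl ()
  player _ _ _ _ := false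
  measurableSet_coord _ _ := .const _
  measurableSet_player _ _ _ _ := .const _

theorem silent_exec (k : ℕ) (In : Type) (X : Fin k → In) (ρ : (silent k In).Coins) (m : ℕ) :
    (silent k In).exec X ρ m = [] :=
  (silent k In).exec_eq_of_inl (m := 0) (y := ()) rfl (Nat.zero_le m)

theorem silent_isFlagged (k : ℕ) (In : Type) : (silent k In).IsFlagged where
  endsRecognizably i X X' ρ ρ' τ τ' y y' h _ hne _ := by
    obtain ⟨⟨m, rfl⟩, -⟩ := h
    rw [silent_exec] at hne
    exact absurd rfl hne
  channel_eq i X ρ τ y h := by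
    obtain ⟨⟨m, rfl⟩, -⟩ := h
    exact Or.inl (by rw [silent_exec, channel_nil])

theorem silent_cost (k : ℕ) (In : Type) : (silent k In).cost ≤ (0 : ℕ) :=
  iSup_le fun X => iSup_le fun ρ => iSup_le fun m => by rw [silent_exec]; simp

theorem Protocol.solves_of_forall_ends {In Out : Type} {Q : Protocol k In Out}
    {R : Problem k In Out} {δ : ℝ} (h : ∀ X ρ, ∃ τ y, Q.Ends X ρ τ y ∧ R.correct X y) :
    Q.Solves R δ := by
  intro X _
  simp [h]

theorem exists_endsRecognizably_solves_setDisjointness (n k : ℕ) (δ : ℝ) :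
    ∃ Q : Protocol k (Finset (Fin n)) Bool,
      Q.EndsRecognizably ∧ Q.Solves (setDisjointness n k) δ := by
  have hP := silent_isFlagged k (Finset (Fin n))
  refine ⟨(silent k (Finset (Fin n))).thenQuery (collectPhase k n) id,
    hP.endsRecognizably_thenQuery (silent_cost _ _), Protocol.solves_of_forall_ends fun X ρ => ?_⟩
  obtain ⟨y, he⟩ := (silent k (Finset (Fin n))).exists_ends_exec (silent_cost k _)
    (fun i => id (X i)) ρ
  exact ⟨_, _, hP.ends_exchange (S := collectPhase k n) he, by simp [setDisjointness, collectPhase]⟩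

theorem Protocol.EndsRecognizably.isFlagged_flag {In Out : Type} {P : Protocol k In Out}
    (hP : P.EndsRecognizably) : P.flag.IsFlagged :=
  ⟨hP.flag, fun i _ _ _ _ h => P.channel_of_flag_ends h i⟩

theorem taskAllocation_promise_compl {X : Fin k → Finset (Fin n)} (hX : ¬ ∃ j, ∀ i, j ∈ X i) :
    (taskAllocation n k).promise fun i => (X i)ᶜ := by
  simpa [taskAllocation] using hX

theorem Protocol.Solves.thenQuery_verifyPhase {δ : ℝ}
    {P : Protocol k (Finset (Fin n)) (Fin n → Fin k)} (hsol : P.Solves (taskAllocation n k) δ)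
    (hP : P.EndsRecognizably) {C : ℕ} (hC : P.flag.cost ≤ C)
    {f : Fin n → List Bool} {L : ℕ} (hf : ∀ j, (f j).length = L)
    (hinj : Function.Injective f) :
    (P.flag.thenQuery (verifyPhase f hf hinj) fun x => xᶜ).Solves (setDisjointness n k) δ := by
  intro X _
  have hend : ∀ ρ : P.Coins, ∃ τ Y, P.Ends (fun i => (X i)ᶜ) ρ τ Y ∧ ∃ σ b,
      (P.flag.thenQuery (verifyPhase f hf hinj) fun x => xᶜ).Ends X ρ σ b ∧
        (b = true ↔ ∃ j, j ∈ X (Y j)) := by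
    intro ρ
    obtain ⟨Y, he⟩ := P.flag.exists_ends_exec hC (fun i => (X i)ᶜ) ρ
    obtain ⟨τ, hτ, -⟩ := P.exists_ends_of_flag_ends he
    exact ⟨τ, Y, hτ, _, _, hP.isFlagged_flag.ends_exchange he, verifyPhase_ans f hf hinj X Y⟩
  by_cases hX : ∃ j, ∀ i, j ∈ X i
  · have hempty : {ρ | ¬ ∃ σ b,
        (P.flag.thenQuery (verifyPhase f hf hinj) fun x => xᶜ).Ends X ρ σ b ∧
          (setDisjointness n k).correct X b} = ∅ := by
      refine Set.eq_empty_of_forall_notMem fun ρ hρ => hρ ?_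
      obtain ⟨τ, Y, -, σ, b, hσ, hb⟩ := hend ρ
      obtain ⟨j, hj⟩ := hX
      exact ⟨σ, b, hσ, hb.trans ⟨fun _ => ⟨j, hj⟩, fun _ => ⟨j, hj _⟩⟩⟩
    rw [hempty, measure_empty]
    exact zero_le
  · refine le_trans (measure_mono fun ρ hρ => ?_) (hsol _ (taskAllocation_promise_compl hX))
    rintro ⟨τ', Y', he', hY'⟩
    obtain ⟨τ, Y, hτ, σ, b, hσ, hb⟩ := hend ρ
    obtain ⟨-, rfl⟩ := hτ.unique he'
    exact hρ ⟨σ, b, hσ, hb.trans ⟨fun ⟨j, hj⟩ => absurd hj (Finset.mem_compl.1 (hY' j)),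
      fun h => absurd h hX⟩⟩

theorem clog_two_add_one_le {n : ℕ} (hn : 2 ≤ n) :
    (Nat.clog 2 n : ℝ) + 1 ≤ 10 * Real.log n := by
  have hlog : Real.log 2 ≤ Real.log n := Real.log_le_log (by norm_num) (by exact_mod_cast hn)
  have hpred : ((Nat.clog 2 n).pred : ℝ) * Real.log 2 ≤ Real.log n := by
    rw [← Real.log_pow]
    exact Real.log_le_log (by positivity)
      (by exact_mod_cast (Nat.pow_pred_clog_lt_self (by norm_num) hn).le)
  have hclog : (Nat.clog 2 n : ℝ) = ((Nat.clog 2 n).pred : ℝ) + 1 := by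
    exact_mod_cast (Nat.succ_pred_eq_of_pos (Nat.clog_pos (by norm_num) hn)).symm
  rw [hclog]
  nlinarith [Real.log_two_gt_d9]

theorem mul_clog_add_le {n k : ℕ} (h : n = 0 ∨ 0 < k) :
    ((n * (Nat.clog 2 n + 1) + 4 * k : ℕ) : ℝ) ≤ 10 * ((n : ℝ) * Real.log n + k) := by
  push_cast
  rcases Nat.lt_or_ge n 2 with hn | hn
  · interval_cases n
    · simp only [Nat.cast_zero, zero_mul, zero_add]
      linarith [Nat.cast_nonneg (α := ℝ) k]
    · have hk1 : (1 : ℝ) ≤ k := by exact_mod_cast h.resolve_left one_ne_zero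
      simp only [Nat.cast_one, Real.log_one, Nat.clog_one_right, CharP.cast_eq_zero]
      linarith
  · linarith [mul_le_mul_of_nonneg_left (clog_two_add_one_le hn) (Nat.cast_nonneg n)]

theorem Protocol.eq_zero_or_pos {In : Type} (P : Protocol k In (Fin n → Fin k)) :
    n = 0 ∨ 0 < k := by
  rcases Nat.eq_zero_or_pos k with rfl | hk
  · refine Or.inl (by_contra fun hn => ?_)
    obtain ⟨r⟩ : Nonempty P.CoordCoins := P.coordLaw.nonempty_of_neZero
    rcases P.coord r [] with Y | e
    · exact (Y ⟨0, Nat.pos_of_ne_zero hn⟩).elim0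
    · exact e.1.elim0
  · exact Or.inr hk

theorem exists_setDisjointness_protocol {δ : ℝ}
    {P : Protocol k (Finset (Fin n)) (Fin n → Fin k)} (hP : P.EndsRecognizably)
    (hsol : P.Solves (taskAllocation n k) δ) :
    ∃ Q : Protocol k (Finset (Fin n)) Bool,
      Q.EndsRecognizably ∧ Q.Solves (setDisjointness n k) δ ∧
      (Q.cost : ℝ≥0∞) ≤ (P.cost : ℝ≥0∞) + ENNReal.ofReal (10 * ((n : ℝ) * Real.log n + k)) := by
  by_cases htop : P.cost = ⊤
  · obtain ⟨Q, hQ, hQ'⟩ := exists_endsRecognizably_solves_setDisjointness n k δ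
    exact ⟨Q, hQ, hQ', by simp [htop]⟩
  obtain ⟨C, hC⟩ := ENat.ne_top_iff_exists.1 htop
  have hflag : P.flag.cost ≤ ((C + k : ℕ) : ℕ∞) :=
    P.flag_cost_le.trans (by rw [← hC, Nat.cast_add])
  obtain ⟨f, hinj, hf⟩ := exists_injective_length_eq_clog n
  refine ⟨P.flag.thenQuery (verifyPhase f hf hinj) fun x => xᶜ,
    hP.isFlagged_flag.endsRecognizably_thenQuery hflag,
    hsol.thenQuery_verifyPhase hP hflag hf hinj, ?_⟩
  have hcost : (P.flag.thenQuery (verifyPhase f hf hinj) fun x => xᶜ).cost ≤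
      P.cost + (n * (Nat.clog 2 n + 1) + 4 * k : ℕ) :=
    calc _ ≤ P.flag.cost + (n * (Nat.clog 2 n + 1) + k + k * (1 + 1) : ℕ) :=
          hP.isFlagged_flag.cost_thenQuery_le hflag fun Y => (sum_length_verifyPhase hf hinj Y).le
      _ ≤ P.cost + k + (n * (Nat.clog 2 n + 1) + k + k * (1 + 1) : ℕ) := by
          gcongr
          exact P.flag_cost_le
      _ = _ := by
          rw [← hC]
          norm_cast
          omega
  calc _ ≤ ((P.cost + (n * (Nat.clog 2 n + 1) + 4 * k : ℕ) : ℕ∞) : ℝ≥0∞) := by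
        exact_mod_cast hcost
    _ = (P.cost : ℝ≥0∞) + ENNReal.ofReal ((n * (Nat.clog 2 n + 1) + 4 * k : ℕ) : ℝ) := by
        rw [ENNReal.ofReal_natCast]
        push_cast
        rfl
    _ ≤ _ := by
        gcongr
        exact mul_clog_add_le P.eq_zero_or_pos

end Reduction

theorem exists_forall_mul_log_le_imp_le (b : ℝ) :
    ∃ n₀ : ℕ, ∀ a : ℝ, 1 ≤ a → ∀ n : ℕ, n₀ ≤ n → ∀ t : ℝ, a * Real.log n ≤ t → b ≤ t := by
  obtain ⟨n₀, hn₀⟩ := exists_nat_ge (Real.exp b)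
  refine ⟨n₀, fun a ha n hn t ht => ?_⟩
  have hexp : Real.exp b ≤ n := hn₀.trans (Nat.cast_le.2 hn)
  calc b ≤ Real.log n := (Real.le_log_iff_exp_le ((Real.exp_pos b).trans_le hexp)).2 hexp
    _ ≤ a * Real.log n := le_mul_of_one_le_left (Real.log_natCast_nonneg n) ha
    _ ≤ t := ht

end Coordinator

theorem mainTheorem6_general :
    (∃ K : ℝ, 0 < K ∧
      ∀ (n k : ℕ) (δ : ℝ), 0 ≤ δ →
        ∀ P : Coordinator.Protocol k (Finset (Fin n)) (Fin n → Fin k),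
          P.EndsRecognizably → P.Solves (Coordinator.taskAllocation n k) δ →
          ∃ Q : Coordinator.Protocol k (Finset (Fin n)) Bool,
            Q.EndsRecognizably ∧ Q.Solves (Coordinator.setDisjointness n k) δ ∧
            (Q.cost : ℝ≥0∞) ≤
              (P.cost : ℝ≥0∞) + ENNReal.ofReal (K * ((n : ℝ) * Real.log n + k))) ∧
    (∀ δ : ℝ, 0 ≤ δ → δ < 1 →
      ∃ c : ℝ, 0 < c ∧ ∃ n₀ k₀ : ℕ, ∀ n : ℕ, n₀ ≤ n → ∀ k : ℕ, k₀ ≤ k →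
        ENNReal.ofReal (c * ((n : ℝ) * k)) ≤
          ((Coordinator.taskAllocation n k).cc δ : ℝ≥0∞)) := by
  refine ⟨⟨10, by norm_num, fun n k δ _ P hP hsol =>
    Coordinator.exists_setDisjointness_protocol hP hsol⟩, fun δ hδ0 hδ1 => ?_⟩
  obtain ⟨n₀, hn₀⟩ := exists_nat_ge (64800 / (1 - δ) ^ 2)
  obtain ⟨k₀, hk₀⟩ := exists_nat_ge (5 / (1 - δ))
  exact ⟨(1 - δ) ^ 2 / 64800, div_pos (pow_pos (sub_pos.2 hδ1) 2) (by norm_num), n₀, k₀,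
    fun n hn k hk => Coordinator.le_cc_taskAllocation hδ0 hδ1 (hn₀.trans (Nat.cast_le.2 hn))
      (hk₀.trans (Nat.cast_le.2 hk))⟩

theorem mainTheorem6 :
    (∃ K : ℝ, 0 < K ∧
      ∀ (n k : ℕ) (δ : ℝ), 0 ≤ δ →
        ∀ P : Coordinator.Protocol k (Finset (Fin n)) (Fin n → Fin k),
          P.EndsRecognizably → P.Solves (Coordinator.taskAllocation n k) δ →
          ∃ Q : Coordinator.Protocol k (Finset (Fin n)) Bool,
            Q.EndsRecognizably ∧ Q.Solves (Coordinator.setDisjointness n k) δ ∧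
            (Q.cost : ℝ≥0∞) ≤
              (P.cost : ℝ≥0∞) + ENNReal.ofReal (K * ((n : ℝ) * Real.log n + k))) ∧
    (∀ δ : ℝ, 0 ≤ δ → δ < 1 →
      ∃ c : ℝ, 0 < c ∧ ∃ a₀ : ℝ, 0 < a₀ ∧ ∃ n₀ : ℕ,
        ∀ a : ℝ, a₀ ≤ a → ∀ n : ℕ, n₀ ≤ n → ∀ k : ℕ, a * Real.log n ≤ (k : ℝ) →
          ENNReal.ofReal (c * ((n : ℝ) * k)) ≤
            ((Coordinator.taskAllocation n k).cc δ : ℝ≥0∞)) := by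
  refine ⟨mainTheorem6_general.1, fun δ hδ0 hδ1 => ?_⟩
  obtain ⟨c, hc, n₀, k₀, h⟩ := mainTheorem6_general.2 δ hδ0 hδ1
  obtain ⟨n₁, hk⟩ := Coordinator.exists_forall_mul_log_le_imp_le k₀
  exact ⟨c, hc, 1, one_pos, max n₀ n₁, fun a ha n hn k hak =>
    h n (le_of_max_le_left hn) k (Nat.cast_le.1 (hk a ha n (le_of_max_le_right hn) k hak))⟩
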